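/- **Setting.** Let $\langle u,w\rangle = u_1w_1+u_2w_2-u_0w_0$ be the Lorentz form on Minkowski space $\mathbb{R}^{2,1}$ with orthonormal basis $(e_1,e_2,e_0)$. Let $L^+_{\mathbb Q}$ (resp. $T^+_{\mathbb Q}$) be the set of vectors $v$ with rational coordinates, positive $e_0$-coordinate and $\langle v,v\rangle=0$ (resp. $\langle v,v\rangle<0$). Such a vector represents a point of $\partial H^2=\mathbb R\cup\{\infty\}$ (resp. of $H^2$), namely the root in the closed upper half-plane of the quadratic form $Az^2+2Bz+C$ with $A=\langle v,e_2+e_0\rangle$, $B=\langle v,e_1\rangle$, $C=\langle v,-e_2+e_0\rangle$. For $f\in T^+_{\mathbb Q}$ let $\rho_f$ be the rotation by $\pi$ about $f$, given by $v\mapsto \frac{2\langle v,f\rangle}{\langle f,f\rangle}f-v$ on $\mathbb{R}^{2,1}$ and by the class of $\begin{pmatrix}-B&-C\\A&B\end{pmatrix}$ in $\mathrm{PGL}_2(\mathbb Q)$, where $A,B,C$ are taken at $f$. Given a boundary point $v_\infty$, order $\partial H^2\setminus\{v_\infty\}$ as the real line is ordered when $v_\infty$ is placed at $\infty$ in the upper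 half-plane model. A Fuchsian group is a discrete subgroup of $\mathrm{PSL}_2(\mathbb R)$, and $\operatorname{HFix}(\Delta)\subset\partial H^2$ is the set of points fixed by some hyperbolic element of $\Delta$. **Rational polygon construction.** Let $n\ge 2$, let $v_0,v_\infty,y_1,\dots,y_{n-1}\in L^+_{\mathbb Q}$ represent boundary points with $v_0,y_1,\dots,y_{n-1}\neq v_\infty$ and $v_0<y_1<\dots<y_{n-1}$. Write $\rho_i=\rho_{f_i}$, and let $\overline{xy}$ be the geodesic line with ends $x,y$. Choose vectors as follows. * Step $1$: $x_1\in L^+_{\mathbb Q}$ with $v_0<x_1<y_1$ and $f_1\in T^+_{\mathbb Q}$ on $\overline{x_1y_1}$; put $v_1=\rho_1(v_0)$. * Step $i$ ($2\le i\le n-1$): $f_i\in T^+_{\mathbb Q}$ on $\overline{x_{i-1}y_{i-1}}$ such that $x_i=\rho_i(y_i)$ and $v_i=\rho_i(v_{i-1})$ satisfy $v_{i-1}<x_i<y_{i-1}<v_i<y_i$. * Step $n$: $f_n\in T^+_{\mathbb Q}$ represents $\overline{x_{n-1}y_{n-1}}\cap\overline{v_{n-1}v_\infty}$; put $v_n=\rho_n(v_{n-1})$.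 * Last step: $f_0\in T^+_{\mathbb Q}$ lies in the span of the vector $v_n+v_0$. Let $\Gamma\le\mathrm{PGL}_2(\mathbb Q)$ be the group generated by $\rho_0,\rho_1,\dots,\rho_n$. **Proposition.** Let $n\ge2$ and let $v_0,v_\infty,y_1,\dots,y_{n-1}\in L^+_{\mathbb Q}$ be as above. Then there are infinitely many subgroups $\Delta\le\mathrm{PSL}_2(\mathbb Q)$ such that $\Delta$ is a non-cocompact Fuchsian group of finite covolume, $\{y_1,\dots,y_{n-1}\}\subset\operatorname{HFix}(\Delta)$, and, for some group $\Gamma$ obtained from the rational polygon construction for these data, $\Delta$ is the kernel of $\Gamma\to\mathrm{PGL}_2(\mathbb Q)/\mathrm{PSL}_2(\mathbb Q)$ (that is, $\Delta=\Gamma\cap\mathrm{PSL}_2(\mathbb Q)$) and has finite index in $\Gamma$. -/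

import Mathlib

open MeasureTheory
open scoped MatrixGroups UpperHalfPlane

noncomputable section

namespace RatFuchsian

/-! ### Fuchsian groups as discrete subgroups of `PSL(2, ℝ)` -/

/-- `PSL(2, ℝ)` acts on the upper half-plane by Möbius transformations. -/
instance pslAction : MulAction PSL(2, ℝ) ℍ :=
  MulAction.compHom ℍ (Matrix.ProjectiveSpecialLinearGroup.toPGL (n := Fin 2) (R := ℝ))

/-- A Fuchsian group: a discrete subgroup of `PSL(2, ℝ)` (with its quotient topology). -/
def IsFuchsian (G : Subgroup PSL(2, ℝ)) : Prop :=
  DiscreteTopology G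

/-- `G` has finite covolume: it has a fundamental domain of finite hyperbolic area
(`volume` on `ℍ` is `dx dy / y ^ 2`). -/
def HasFiniteCovolume (G : Subgroup PSL(2, ℝ)) : Prop :=
  ∃ F : Set ℍ, IsFundamentalDomain G F (volume : Measure ℍ) ∧ (volume : Measure ℍ) F < ⊤

/-- `G` is cocompact: the quotient of the hyperbolic plane by `G` is compact. -/
def IsCocompact (G : Subgroup PSL(2, ℝ)) : Prop :=
  CompactSpace (MulAction.orbitRel.Quotient G ℍ)

/-- The set of hyperbolic fixed points: the points of the boundary `ℝ ∪ {∞}` that are fixed by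
a hyperbolic element of `G`. -/
def HFix (G : Subgroup PSL(2, ℝ)) : Set (OnePoint ℝ) :=
  {p | ∃ g : SL(2, ℝ), (QuotientGroup.mk g : PSL(2, ℝ)) ∈ G ∧
    (g : Matrix (Fin 2) (Fin 2) ℝ).IsHyperbolic ∧
    Matrix.SpecialLinearGroup.toGL g • p = p}

theorem center_le_comap :
    Subgroup.center SL(2, ℚ) ≤
      (Subgroup.center SL(2, ℝ)).comap
        (Matrix.SpecialLinearGroup.map (n := Fin 2) (algebraMap ℚ ℝ)) := by
  intro g hg
  rw [Matrix.SpecialLinearGroup.mem_center_iff] at hg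
  obtain ⟨r, hr, h⟩ := hg
  rw [Subgroup.mem_comap, Matrix.SpecialLinearGroup.mem_center_iff]
  refine ⟨algebraMap ℚ ℝ r, by rw [← map_pow, hr, map_one], ?_⟩
  ext i j
  have hij := congrFun (congrFun h i) j
  by_cases e : i = j
  · subst e
    simpa using congrArg (algebraMap ℚ ℝ) hij
  · simpa [Matrix.scalar_apply, Matrix.diagonal_apply_ne _ e] using
      congrArg (algebraMap ℚ ℝ) hij

/-- The inclusion `PSL(2, ℚ) → PSL(2, ℝ)`. -/
def ratToReal : PSL(2, ℚ) →* PSL(2, ℝ) :=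
  QuotientGroup.map _ _ (Matrix.SpecialLinearGroup.map (n := Fin 2) (algebraMap ℚ ℝ))
    center_le_comap

/-! ### Rational Minkowski space and the boundary of the hyperbolic plane -/

/-- The rational points of Minkowski space: `v i` is the coordinate of `v` along `e_i`, where
`(e₁, e₂, e₀)` is a Lorentz orthonormal basis. -/
abbrev Mink : Type := Fin 3 → ℚ

/-- The basis vector `e_i`. -/
def e (i : Fin 3) : Mink := Pi.single i 1

/-- The Lorentz form, with `⟨e₁, e₁⟩ = ⟨e₂, e₂⟩ = 1` and `⟨e₀, e₀⟩ = -1`. -/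
def form (u w : Mink) : ℚ := u 1 * w 1 + u 2 * w 2 - u 0 * w 0

/-- Rational light-like vectors with positive `e₀`-coordinate; each of them represents a point
of the boundary of the hyperbolic plane (its ray). -/
def LightPlus : Set Mink := {v | form v v = 0 ∧ 0 < v 0}

/-- Rational time-like vectors with positive `e₀`-coordinate; each of them represents a point
of the hyperbolic plane (its ray). -/
def TimePlus : Set Mink := {v | form v v < 0 ∧ 0 < v 0}

/-- The symmetric matrix attached to a vector; its determinant is `-⟨v, v⟩`. -/
def symMatrix (v : Mink) : Matrix (Fin 2) (Fin 2) ℚ :=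
  !![form v (e 2 + e 0), form v (e 1); form v (e 1), form v (-e 2 + e 0)]

/-- The point of `∂ℍ = ℝ ∪ {∞}` represented by a light-like vector: the double root of the
quadratic form `A z² + 2 B z + C` given by the matrix `symMatrix v`, that is
`-⟨v, e₁⟩ / ⟨v, e₂ + e₀⟩`. -/
def bdry (v : Mink) : OnePoint ℝ :=
  if form v (e 2 + e 0) = 0 then OnePoint.infty
  else ((-form v (e 1) / form v (e 2 + e 0) : ℚ) : ℝ)

/-- The order `x < y` on the boundary minus the point `p`: the triple `(p, x, y)` is positively
oriented. When `p` is the point `∞` (the ray of `e₂ + e₀`) this is the order of the real line in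
the upper half-plane. It implies that `p`, `x`, `y` are pairwise distinct boundary points. -/
def BLt (p x y : Mink) : Prop := 0 < (Matrix.of ![p, x, y]).det

/-- The rational points of the (open) geodesic line with the boundary points `x` and `y` as its
ends. -/
def line (x y : Mink) : Set Mink :=
  {f | ∃ s t : ℚ, 0 < s ∧ 0 < t ∧ f = s • x + t • y}

/-- The rotation by `π` with fixed point `f`, as a Lorentz transformation: it fixes `f` and is
`-1` on the orthogonal complement of `f`. -/
def rot (f v : Mink) : Mink := (2 * form v f / form f f) • f - v

/-- The rotation by `π` with fixed point `f` as a Möbius transformation. If `a + b i` is the root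
of the form `symMatrix f` then this is `(1 / b) [a, -(a² + b²); 1, -a]` up to a scalar. -/
def rotMatrix (f : Mink) : Matrix (Fin 2) (Fin 2) ℚ :=
  !![-symMatrix f 0 1, -symMatrix f 1 1; symMatrix f 0 0, symMatrix f 0 1]

theorem rotMatrix_det (f : Mink) : (rotMatrix f).det = -form f f := by
  simp [rotMatrix, symMatrix, Matrix.det_fin_two, form, e]
  ring

/-- The class in `PGL(2, ℚ)` of the rotation by `π` with fixed point `f`. -/
def rotPGL (f : Mink) (hf : f ∈ TimePlus) : PGL(2, ℚ) :=
  Matrix.ProjGenLinGroup.mk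
    (Matrix.GeneralLinearGroup.mkOfDetNeZero (rotMatrix f)
      (by rw [rotMatrix_det]; exact neg_ne_zero.mpr hf.1.ne))

/-! ### The polygon construction -/

/-- The vectors `x₁, …, x_{n-1}`, `v₀, …, v_n`, `f₀, …, f_n` of `ℚ^{2,1}` are the outcome of the
polygon construction from the boundary points `v₀ < y₁ < ⋯ < y_{n-1}` and `v∞` (`vinf`).
Values of the sequences at other indices play no role. -/
structure IsPolygonConstruction (n : ℕ) (v₀ vinf : Mink) (y x v f : ℕ → Mink) : Prop where
  f_mem : ∀ i ≤ n, f i ∈ TimePlus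
  v_zero : v 0 = v₀
  /-- `v_i = ρ_i (v_{i-1})` for `1 ≤ i ≤ n`. -/
  v_succ : ∀ i < n, v (i + 1) = rot (f (i + 1)) (v i)
  /-- Step `1`: `v₀ < x₁ < y₁`, and `f₁` is on the line from `x₁` to `y₁`. -/
  x_one_mem : x 1 ∈ LightPlus
  v_zero_lt_x_one : BLt vinf v₀ (x 1)
  x_one_lt_y_one : BLt vinf (x 1) (y 1)
  f_one : f 1 ∈ line (x 1) (y 1)
  /-- Step `i + 1`, for `2 ≤ i + 1 ≤ n - 1`: the point `f_{i+1}` is on the line from `x_i` to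
  `y_i`, and `x_{i+1} = ρ_{i+1} (y_{i+1})`, such that
  `v_i < x_{i+1} < y_i < v_{i+1} < y_{i+1}`. -/
  f_succ : ∀ i, 1 ≤ i → i + 1 < n → f (i + 1) ∈ line (x i) (y i)
  x_succ : ∀ i, 1 ≤ i → i + 1 < n → x (i + 1) = rot (f (i + 1)) (y (i + 1))
  ordered : ∀ i, 1 ≤ i → i + 1 < n →
    BLt vinf (v i) (x (i + 1)) ∧ BLt vinf (x (i + 1)) (y i) ∧
      BLt vinf (y i) (v (i + 1)) ∧ BLt vinf (v (i + 1)) (y (i + 1))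
  /-- Step `n`: `f_n` is the intersection of the line from `x_{n-1}` to `y_{n-1}` with the line
  from `v_{n-1}` to `v∞`. -/
  f_last : f n ∈ line (x (n - 1)) (y (n - 1)) ∩ line (v (n - 1)) vinf
  /-- Last step: `f₀` is in the span of `v_n + v₀`. -/
  f_zero : ∃ c : ℚ, f 0 = c • (v n + v₀)

/-- The group `Γ` generated by the rotations by `π` with fixed points `f₀, …, f_n`. -/
def polygonGroup (n : ℕ) (f : ℕ → Mink) : Subgroup PGL(2, ℚ) :=
  Subgroup.closure {g | ∃ i ≤ n, ∃ hf : f i ∈ TimePlus, g = rotPGL (f i) hf}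

/-- The kernel of `Γ → PGL(2, ℚ) / PSL(2, ℚ)`, that is `Γ ∩ PSL(2, ℚ)`, as a subgroup of
`PSL(2, ℚ)`. -/
def kernelPSL (Γ : Subgroup PGL(2, ℚ)) : Subgroup PSL(2, ℚ) :=
  Γ.comap Matrix.ProjectiveSpecialLinearGroup.toPGL

end RatFuchsian

end

noncomputable section

namespace RatFuchsian

/-! ### Lorentzian linear algebra -/

/-! The vectors themselves, not only their rays, are tracked. By construction ρ_i exchanges the
vectors v_{i-1} and v_i. The intersection in step n makes v_n a positive multiple of v∞, and f₀ in
the span of v_n + v₀ makes ρ₀ exchange v_n and v₀. The inequalities v_{i-1} < x_i < y_{i-1} < v_i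
put v₀, …, v_n in cyclic order. So Γ is generated by half-turns about points of the sides of an
ideal polygon, and the cycle ρ₀ρ_n⋯ρ₁ fixes the vector v₀: this is the completeness condition at the
cusp (`isIdealPolygon`).

For such a polygon Poincaré's theorem is proved directly. The half-planes beyond distinct sides are
disjoint, so ping-pong on reduced words separates the translates of the open polygon
(`eq_one_of_smul_mem`). The closed polygon meets every orbit by a descent on the distance beyond a
side (`exists_smul_mem_closedPolygon`). Discreteness and finite covolume follow, since the polygon
is a union of finitely many ideal triangles. Non-cocompactness holds because every orbit stays away
from the cusps (`exists_le_ht_vertex_smul`) although some points lie arbitrarily close to one. The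
index of Δ in Γ is finite because Γ/Δ is a finitely generated subgroup of ℚˣ modulo squares.

Both f_i and f_{i+1} lie on the line from x_i to y_i and they are different points, so (ρ_{i+1}ρ_i)²
is a hyperbolic element of Δ with that axis, and y_i lies in HFix(Δ). Finally, x₁ can be any
rational boundary point between v₀ and y₁, and Δ determines it: in a Fuchsian group two axes with
one common end coincide (`IsFuchsian.eq_of_common_end`). Infinitely many choices of x₁ thus give
infinitely many Δ. -/

/-- The determinant of three vectors of Minkowski space. -/
def det3 (a b c : Mink) : ℚ :=
  a 0 * (b 1 * c 2 - b 2 * c 1) - a 1 * (b 0 * c 2 - b 2 * c 0) + a 2 * (b 0 * c 1 - b 1 * c 0)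

theorem BLt_iff {p x y : Mink} : BLt p x y ↔ 0 < det3 p x y := by
  rw [BLt, Matrix.det_fin_three, det3]
  simp only [Matrix.of_apply, Matrix.cons_val]
  constructor <;> intro h <;> linarith

/-- The Lorentzian cross product, dual to the determinant. -/
def cross (a b : Mink) : Mink :=
  ![-(a 1 * b 2 - a 2 * b 1), a 2 * b 0 - a 0 * b 2, a 0 * b 1 - a 1 * b 0]

@[simp] theorem cross_zero' (a b : Mink) : cross a b 0 = -(a 1 * b 2 - a 2 * b 1) := rfl
@[simp] theorem cross_one' (a b : Mink) : cross a b 1 = a 2 * b 0 - a 0 * b 2 := rfl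
@[simp] theorem cross_two' (a b : Mink) : cross a b 2 = a 0 * b 1 - a 1 * b 0 := rfl

theorem mink_ext {u v : Mink} (h0 : u 0 = v 0) (h1 : u 1 = v 1) (h2 : u 2 = v 2) : u = v := by
  funext i
  fin_cases i <;> assumption

theorem form_comm (u v : Mink) : form u v = form v u := by
  simp only [form]; ring

theorem form_add_left (u v w : Mink) : form (u + v) w = form u w + form v w := by
  simp only [form, Pi.add_apply]; ring

theorem form_add_right (u v w : Mink) : form u (v + w) = form u v + form u w := by
  simp only [form, Pi.add_apply]; ring

theorem form_smul_left (c : ℚ) (v w : Mink) : form (c • v) w = c * form v w := by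
  simp only [form, Pi.smul_apply, smul_eq_mul]; ring

theorem form_smul_right (c : ℚ) (v w : Mink) : form v (c • w) = c * form v w := by
  simp only [form, Pi.smul_apply, smul_eq_mul]; ring

theorem det3_rotate (a b c : Mink) : det3 b c a = det3 a b c := by
  simp only [det3]; ring

theorem det3_smul_left (c : ℚ) (u v w : Mink) : det3 (c • u) v w = c * det3 u v w := by
  simp only [det3, Pi.smul_apply, smul_eq_mul]; ring

theorem det3_smul_mid (c : ℚ) (u v w : Mink) : det3 u (c • v) w = c * det3 u v w := by
  simp only [det3, Pi.smul_apply, smul_eq_mul]; ring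

theorem det3_smul_right (c : ℚ) (u v w : Mink) : det3 u v (c • w) = c * det3 u v w := by
  simp only [det3, Pi.smul_apply, smul_eq_mul]; ring

theorem form_cross (a b w : Mink) : form (cross a b) w = det3 a b w := by
  simp only [form, det3, cross_zero', cross_one', cross_two']; ring

theorem cross_swap (a b : Mink) : cross b a = -cross a b := by
  apply mink_ext <;> simp only [Pi.neg_apply, cross_zero', cross_one', cross_two'] <;> ring

/-- The linear relation between four vectors of a three-dimensional space. -/
theorem cramer (a b c p : Mink) :
    det3 a b c • p = det3 p b c • a - det3 p a c • b + det3 p a b • c := by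
  apply mink_ext <;>
    simp only [det3, Pi.add_apply, Pi.sub_apply, Pi.smul_apply, smul_eq_mul] <;> ring

/-- Up to the determinant, the three cross products are the basis dual to `a`, `b`, `d`; this is the
expansion of `b` in it. For light-like `b` the third term drops out, so suitably weighted normals of
two lines ending at `b` add up to a multiple of `b`. -/
theorem cross_add_cross (a b d : Mink) :
    form b d • cross a b + form a b • cross b d + form b b • cross d a = det3 a b d • b := by
  apply mink_ext <;> simp only [det3, form, Pi.add_apply, Pi.smul_apply, smul_eq_mul,
    cross_zero', cross_one', cross_two'] <;> ring

/-- Expansion of a vector in the basis given by two light-like vectors and their cross product. -/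
theorem light_expansion {a b : Mink} (ha : form a a = 0) (hb : form b b = 0) (u : Mink) :
    (form a b) ^ 2 • u =
      (form a b * form u b) • a + (form a b * form u a) • b + det3 a b u • cross a b := by
  simp only [form] at ha hb
  apply mink_ext <;> simp only [det3, form, Pi.add_apply, Pi.smul_apply, smul_eq_mul,
    cross_zero', cross_one', cross_two']
  · linear_combination -(b 0 * (b 1 * u 1 + b 2 * u 2 - b 0 * u 0) -
      u 0 * (b 1 * b 1 + b 2 * b 2 - b 0 * b 0)) * ha -
      (a 0 * (a 1 * u 1 + a 2 * u 2 - a 0 * u 0)) * hb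
  · linear_combination -(b 1 * (b 1 * u 1 + b 2 * u 2 - b 0 * u 0) -
      u 1 * (b 1 * b 1 + b 2 * b 2 - b 0 * b 0)) * ha -
      (a 1 * (a 1 * u 1 + a 2 * u 2 - a 0 * u 0)) * hb
  · linear_combination -(b 2 * (b 1 * u 1 + b 2 * u 2 - b 0 * u 0) -
      u 2 * (b 1 * b 1 + b 2 * b 2 - b 0 * b 0)) * ha -
      (a 2 * (a 1 * u 1 + a 2 * u 2 - a 0 * u 0)) * hb

/-- The squared determinant is minus the Gram determinant, and here the Gram matrix has zero
diagonal. -/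
theorem det3_sq {a b c : Mink} (ha : form a a = 0) (hb : form b b = 0) (hc : form c c = 0) :
    det3 a b c ^ 2 = -2 * form a b * form b c * form c a := by
  have key : det3 a b c ^ 2 = -(form a a * (form b b * form c c - form b c ^ 2)
      - form a b * (form a b * form c c - form b c * form c a)
      + form c a * (form a b * form b c - form b b * form c a)) := by
    simp only [det3, form]; ring
  rw [key, ha, hb, hc]; ring

/-! ### The rotations by `π` -/

theorem rot_smul (f : Mink) (c : ℚ) (v : Mink) : rot f (c • v) = c • rot f v := by
  simp only [rot, form_smul_left, smul_sub, smul_smul]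
  congr 2; ring

theorem form_rot_rot {f : Mink} (hf : form f f ≠ 0) (u v : Mink) :
    form (rot f u) (rot f v) = form u v := by
  have e : form (rot f u) (rot f v) = (2 * form u f / form f f) * (2 * form v f / form f f) *
      form f f - (2 * form u f / form f f) * form v f - (2 * form v f / form f f) * form u f
      + form u v := by
    simp only [rot, form, Pi.sub_apply, Pi.smul_apply, smul_eq_mul]; ring
  rw [e]; field_simp; ring

theorem form_rot_self {f : Mink} (hf : form f f ≠ 0) (u : Mink) :
    form (rot f u) f = form u f := by
  have e : form (rot f u) f = (2 * form u f / form f f) * form f f - form u f := by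
    simp only [rot, form, Pi.sub_apply, Pi.smul_apply, smul_eq_mul]; ring
  rw [e]; field_simp; ring

theorem rot_rot {f : Mink} (hf : form f f ≠ 0) (u : Mink) : rot f (rot f u) = u := by
  rw [rot, form_rot_self hf, rot]; abel

/-- A half-turn is 1 on one line and -1 on a plane, hence has determinant 1. So rotations preserve
the cyclic order of the boundary. -/
theorem det3_rot {f : Mink} (hf : form f f ≠ 0) (a b c : Mink) :
    det3 (rot f a) (rot f b) (rot f c) = det3 a b c := by
  have e : ∀ α β γ : ℚ, det3 (α • f - a) (β • f - b) (γ • f - c) =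
      α * det3 f b c - β * det3 f a c + γ * det3 f a b - det3 a b c := by
    intro α β γ
    simp only [det3, Pi.sub_apply, Pi.smul_apply, smul_eq_mul]; ring
  have k : det3 a b c * form f f =
      det3 f b c * form a f - det3 f a c * form b f + det3 f a b * form c f := by
    simp only [det3, form]; ring
  rw [rot, rot, rot, e]
  field_simp
  linear_combination -2 * k

theorem form_ext {u v : Mink} (h : ∀ w, form u w = form v w) : u = v := by
  have h0 := h (e 0)
  have h1 := h (e 1)
  have h2 := h (e 2)
  simp only [form, e, Pi.single_apply] at h0 h1 h2
  exact mink_ext (by simpa using h0) (by simpa using h1) (by simpa using h2)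

theorem cross_rot {f : Mink} (hf : form f f ≠ 0) (a b : Mink) :
    cross (rot f a) (rot f b) = rot f (cross a b) := by
  refine form_ext fun w => ?_
  rw [← rot_rot hf w, form_cross, det3_rot hf, form_rot_rot hf, form_cross]

/-- The ends of a line through the centre are exchanged up to scale. The factor `t / s` is 1 exactly
for equal weights, when the vectors themselves are exchanged. -/
theorem rot_line_left {a b : Mink} (ha : form a a = 0) (hb : form b b = 0) (hab : form a b ≠ 0)
    {s t : ℚ} (hs : s ≠ 0) (ht : t ≠ 0) : rot (s • a + t • b) a = (t / s) • b := by
  have h1 : form a (s • a + t • b) = t * form a b := by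
    rw [form_add_right, form_smul_right, form_smul_right, ha]; ring
  have h2 : form (s • a + t • b) (s • a + t • b) = 2 * s * t * form a b := by
    simp only [form_add_right, form_smul_right, form_add_left, form_smul_left, ha, hb,
      form_comm b a]
    ring
  have h3 : 2 * (t * form a b) / (2 * s * t * form a b) = 1 / s := by field_simp
  rw [rot, h1, h2, h3, smul_add, smul_smul, smul_smul, one_div, inv_mul_cancel₀ hs, one_smul,
    add_sub_cancel_left]
  congr 1; ring

theorem rot_line_right {a b : Mink} (ha : form a a = 0) (hb : form b b = 0) (hab : form a b ≠ 0)
    {s t : ℚ} (hs : s ≠ 0) (ht : t ≠ 0) : rot (s • a + t • b) b = (s / t) • a := by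
  rw [add_comm]
  exact rot_line_left hb ha (by rwa [form_comm]) ht hs

/-! ### The light cone -/

theorem light_form_nonpos {u v : Mink} (hu : u ∈ LightPlus) (hv : v ∈ LightPlus) :
    form u v ≤ 0 := by
  obtain ⟨hu1, hu2⟩ := hu
  obtain ⟨hv1, hv2⟩ := hv
  simp only [form] at *
  have h : (u 1 * v 1 + u 2 * v 2) ^ 2 ≤ (u 0 * v 0) ^ 2 := by
    have : (u 0 * v 0) ^ 2 = (u 1 * u 1 + u 2 * u 2) * (v 1 * v 1 + v 2 * v 2) := by
      linear_combination (-v 0 * v 0) * hu1 + (-u 1 * u 1 - u 2 * u 2) * hv1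
    rw [this]
    nlinarith [sq_nonneg (u 1 * v 2 - u 2 * v 1)]
  have := abs_le_of_sq_le_sq' h (by positivity)
  linarith [this.2]

theorem form_neg_of_light_time {u f : Mink} (hu : u ∈ LightPlus) (hf : f ∈ TimePlus) :
    form u f < 0 := by
  obtain ⟨hu1, hu2⟩ := hu
  obtain ⟨hf1, hf2⟩ := hf
  simp only [form] at *
  have h : (u 1 * f 1 + u 2 * f 2) ^ 2 < (u 0 * f 0) ^ 2 := by
    have h1 : (u 0 * f 0) ^ 2 = (u 1 * u 1 + u 2 * u 2) * (f 0 * f 0) := by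
      linear_combination (-f 0 * f 0) * hu1
    have h2 : 0 < u 1 * u 1 + u 2 * u 2 := by nlinarith
    rw [h1]
    nlinarith [sq_nonneg (u 1 * f 2 - u 2 * f 1), mul_pos h2 (neg_pos.mpr hf1)]
  have := abs_lt_of_sq_lt_sq' h (by positivity)
  linarith [this.2]

theorem time_form_ne {f : Mink} (hf : f ∈ TimePlus) : form f f ≠ 0 := hf.1.ne

/-- The sign of the pairing with a time-like `f` tells the two halves of the light cone apart, and
`rot f` preserves this pairing. -/
theorem light_rot {u f : Mink} (hu : u ∈ LightPlus) (hf : f ∈ TimePlus) :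
    rot f u ∈ LightPlus := by
  have h1 : form (rot f u) (rot f u) = 0 := by
    rw [form_rot_rot (time_form_ne hf), hu.1]
  refine ⟨h1, ?_⟩
  have h2 : form (rot f u) f < 0 := by
    rw [form_rot_self (time_form_ne hf)]; exact form_neg_of_light_time hu hf
  set w := rot f u
  by_contra h
  rcases (not_lt.mp h).lt_or_eq with h | h
  · have h3 : -w ∈ LightPlus := by
      refine ⟨?_, by simpa using h⟩
      rw [← neg_one_smul ℚ w, form_smul_left, form_smul_right, h1]; ring
    have := form_neg_of_light_time h3 hf
    rw [← neg_one_smul ℚ w, form_smul_left] at this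
    linarith
  · simp only [form, h] at h1 h2
    have hw1 : w 1 = 0 := by nlinarith [sq_nonneg (w 1), sq_nonneg (w 2)]
    have hw2 : w 2 = 0 := by nlinarith [sq_nonneg (w 1), sq_nonneg (w 2)]
    rw [hw1, hw2] at h2
    linarith

theorem time_of_line {a b : Mink} (ha : a ∈ LightPlus) (hb : b ∈ LightPlus)
    (hab : form a b < 0) {s t : ℚ} (hs : 0 < s) (ht : 0 < t) : s • a + t • b ∈ TimePlus := by
  refine ⟨?_, ?_⟩
  · have h2 : form (s • a + t • b) (s • a + t • b) = 2 * (s * t) * form a b := by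
      simp only [form_add_right, form_smul_right, form_add_left, form_smul_left, ha.1, hb.1,
        form_comm b a]
      ring
    rw [h2]
    have := mul_pos hs ht
    nlinarith
  · have := mul_pos hs ha.2
    have := mul_pos ht hb.2
    simp only [Pi.add_apply, Pi.smul_apply, smul_eq_mul]
    linarith

theorem form_neg_of_det3_ne_zero {a b c : Mink} (ha : a ∈ LightPlus) (hb : b ∈ LightPlus)
    (hc : c ∈ LightPlus) (h : det3 a b c ≠ 0) : form a b < 0 := by
  refine lt_of_le_of_ne (light_form_nonpos ha hb) fun h0 => h ?_
  have := det3_sq ha.1 hb.1 hc.1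
  rw [h0] at this
  simpa using this

/-! ### The cyclic order of the boundary -/

section Order

variable {p a b c : Mink}

/-- Pair Cramer's relation for `a`, `b`, `c`, `p` with `p`: the left side vanishes, and since
distinct light rays pair negatively, `det3 p a c` has the sign of the other two determinants. -/
theorem det3_pos_trans (hp : p ∈ LightPlus) (ha : a ∈ LightPlus) (hb : b ∈ LightPlus)
    (hc : c ∈ LightPlus) (hab : 0 < det3 p a b) (hbc : 0 < det3 p b c) : 0 < det3 p a c := by
  have h := congrArg (fun v => form v p) (cramer a b c p)
  simp only [sub_eq_add_neg, ← neg_smul, form_smul_left, form_add_left, hp.1, mul_zero] at h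
  have h1 : form a p < 0 := by
    rw [form_comm]; exact form_neg_of_det3_ne_zero hp ha hb hab.ne'
  have h2 : form b p < 0 := by
    rw [form_comm]; exact form_neg_of_det3_ne_zero hp hb hc hbc.ne'
  have h3 : form c p ≤ 0 := light_form_nonpos hc hp
  nlinarith [mul_pos hbc (neg_pos.mpr h1), mul_nonneg hab.le (neg_nonneg.mpr h3)]

/-- The same relation paired with `b`, which removes the term of `det3 p a c`. -/
theorem det3_pos_of_trans (hp : p ∈ LightPlus) (ha : a ∈ LightPlus) (hb : b ∈ LightPlus)
    (hc : c ∈ LightPlus) (hab : 0 < det3 p a b) (hbc : 0 < det3 p b c) : 0 < det3 a b c := by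
  have h := congrArg (fun v => form v b) (cramer a b c p)
  simp only [sub_eq_add_neg, ← neg_smul, form_smul_left, form_add_left, hb.1, mul_zero] at h
  have h1 : form p b < 0 := form_neg_of_det3_ne_zero hp hb hc hbc.ne'
  have h2 : form a b < 0 := by
    rw [← det3_rotate] at hab
    exact form_neg_of_det3_ne_zero ha hb hp hab.ne'
  have h3 : form c b ≤ 0 := light_form_nonpos hc hb
  nlinarith [mul_pos hbc (neg_pos.mpr h2), mul_nonneg hab.le (neg_nonneg.mpr h3)]

/-- If `a < b` and `c` is in the arc from `a` to `b`, then `a < c < b`. -/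
theorem between_of_det3 (hp : p ∈ LightPlus) (ha : a ∈ LightPlus) (hb : b ∈ LightPlus)
    (hc : c ∈ LightPlus) (hab : 0 < det3 p a b) (hacb : 0 < det3 a c b) :
    0 < det3 p a c ∧ 0 < det3 p c b := by
  have h : 0 < det3 a b p := by rwa [det3_rotate]
  constructor
  · rw [← det3_rotate]; exact det3_pos_trans ha hc hb hp hacb h
  · rw [← det3_rotate]; exact det3_pos_of_trans ha hc hb hp hacb h

/-- For points in cyclic order the signs in Cramer's relation alternate; moving the negative terms
to the other side gives one vector on both chords, with rational coefficients. -/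
theorem exists_crossing {x w y q : Mink} (h1 : 0 < det3 w y q) (h2 : 0 < det3 x w q)
    (h3 : 0 < det3 x y q) (h4 : 0 < det3 x w y) : ∃ f, f ∈ line x y ∧ f ∈ line w q := by
  refine ⟨det3 w y q • x + det3 x w q • y, ⟨_, _, h1, h2, rfl⟩, ⟨_, _, h3, h4, ?_⟩⟩
  apply mink_ext <;>
    simp only [det3, Pi.add_apply, Pi.smul_apply, smul_eq_mul] <;> ring

/-- The rotations about the points of the line from `a` to `b` map `p` between `a` and `b`. -/
theorem rot_between (hp : p ∈ LightPlus) (ha : a ∈ LightPlus) (hb : b ∈ LightPlus)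
    (hab : 0 < det3 p a b) {f : Mink} (hf : f ∈ line a b) :
    rot f p ∈ LightPlus ∧ 0 < det3 p a (rot f p) ∧ 0 < det3 p (rot f p) b := by
  obtain ⟨s, t, hs, ht, rfl⟩ := hf
  have hn : form a b < 0 := by
    rw [← det3_rotate] at hab; exact form_neg_of_det3_ne_zero ha hb hp hab.ne'
  have hT := time_of_line ha hb hn hs ht
  have hL := light_rot hp hT
  refine ⟨hL, between_of_det3 hp ha hb hL hab ?_⟩
  -- The scale factors `t / s` and `s / t` cancel. As `a` and `b` are exchanged, the image of `p`
  -- lies on the arc between them that avoids `p`.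
  have h := det3_rot (time_form_ne hT) p a b
  rw [rot_line_left ha.1 hb.1 hn.ne hs.ne' ht.ne', rot_line_right ha.1 hb.1 hn.ne hs.ne' ht.ne',
    det3_smul_mid, det3_smul_right, ← mul_assoc, div_mul_div_cancel₀ hs.ne', div_self ht.ne',
    one_mul] at h
  have h' := det3_rotate b a (rot (s • a + t • b) p)
  have h'' := det3_rotate a (rot (s • a + t • b) p) b
  linarith

end Order

/-! ### Ideal polygons with rotations about points of their sides -/

/-- An ideal polygon with the vertices `V i`, the vertex before `V i` being `V (prev i)`, together
with rotations by `π`, about points `f i`, which interchange the vectors `V (prev i)` and `V i`. -/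
structure IsIdealPolygon {ι : Type*} (V : ι → Mink) (prev : ι → ι) (f : ι → Mink) : Prop where
  light : ∀ i, V i ∈ LightPlus
  time : ∀ i, f i ∈ TimePlus
  rot_prev : ∀ i, rot (f i) (V (prev i)) = V i
  prev_ne : ∀ i, prev i ≠ i
  prev_prev_ne : ∀ i, prev (prev i) ≠ i
  form_neg : ∀ i j, i ≠ j → form (V i) (V j) < 0
  det_pos : ∀ i j, i ≠ j → i ≠ prev j → 0 < det3 (V (prev j)) (V j) (V i)

/-! ### The construction yields an ideal polygon -/

namespace IsPolygonConstruction

variable {n : ℕ} {v₀ vinf : Mink} {y x v f : ℕ → Mink}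

theorem v_light (h : IsPolygonConstruction n v₀ vinf y x v f) (hv₀ : v₀ ∈ LightPlus) :
    ∀ i ≤ n, v i ∈ LightPlus
  | 0, _ => by rw [h.v_zero]; exact hv₀
  | i + 1, hi => by
    rw [h.v_succ i hi]
    exact light_rot (h.v_light hv₀ i (Nat.le_of_succ_le hi)) (h.f_mem _ hi)

theorem x_light (h : IsPolygonConstruction n v₀ vinf y x v f)
    (hy : ∀ i, 1 ≤ i → i < n → y i ∈ LightPlus) :
    ∀ i, 1 ≤ i → i < n → x i ∈ LightPlus := by
  intro i h1 h2
  obtain ⟨i, rfl⟩ := Nat.exists_eq_add_of_le' h1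
  rcases Nat.eq_zero_or_pos i with rfl | hi
  · exact h.x_one_mem
  · rw [h.x_succ i hi h2]
    exact light_rot (hy _ h1 h2) (h.f_mem _ h2.le)

/-- For i = 0 the half-turn ρ₁ exchanges x₁ and y₁ and so maps v₀ between them; afterwards the chain
v_i < x_{i+1} < y_i < v_{i+1} is part of the construction. -/
theorem v_lt_v_succ (h : IsPolygonConstruction n v₀ vinf y x v f) (hn : 2 ≤ n)
    (hv₀ : v₀ ∈ LightPlus) (hvinf : vinf ∈ LightPlus)
    (hy : ∀ i, 1 ≤ i → i < n → y i ∈ LightPlus) (i : ℕ) (hi : i + 1 < n) :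
    0 < det3 vinf (v i) (v (i + 1)) := by
  have hv := h.v_light hv₀
  have hx := h.x_light hy
  rcases Nat.eq_zero_or_pos i with rfl | hi0
  · have hx1 := h.x_one_mem
    have hy1 := hy 1 le_rfl hn
    have h1 := BLt_iff.mp h.v_zero_lt_x_one
    have h2 := BLt_iff.mp h.x_one_lt_y_one
    have h3 := det3_pos_of_trans hvinf hv₀ hx1 hy1 h1 h2
    have h4 := (rot_between hv₀ hx1 hy1 h3 h.f_one)
    have hv1 := hv 1 (by omega)
    have e1 : v 1 = rot (f 1) v₀ := by rw [h.v_succ 0 (by omega), h.v_zero]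
    rw [← e1] at h4
    have h5 : 0 < det3 (x 1) (v 1) (y 1) := det3_pos_of_trans hv₀ hx1 hv1 hy1 h4.2.1 h4.2.2
    have h6 := between_of_det3 hvinf hx1 hy1 hv1 h2 h5
    rw [h.v_zero]
    exact det3_pos_trans hvinf hv₀ hx1 hv1 h1 h6.1
  · obtain ⟨h1, h2, h3, -⟩ := h.ordered i hi0 hi
    rw [BLt_iff] at h1 h2 h3
    exact det3_pos_trans hvinf (hv i (by omega)) (hx _ (by omega) hi) (hv _ hi.le) h1
      (det3_pos_trans hvinf (hx _ (by omega) hi) (hy i hi0 (by omega)) (hv _ hi.le) h2 h3)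

theorem v_lt_v (h : IsPolygonConstruction n v₀ vinf y x v f) (hn : 2 ≤ n)
    (hv₀ : v₀ ∈ LightPlus) (hvinf : vinf ∈ LightPlus)
    (hy : ∀ i, 1 ≤ i → i < n → y i ∈ LightPlus) (i j : ℕ) (hij : i < j) (hj : j < n) :
    0 < det3 vinf (v i) (v j) := by
  have hv := h.v_light hv₀
  induction j, hij using Nat.le_induction with
  | base => exact h.v_lt_v_succ hn hv₀ hvinf hy i hj
  | succ j hij ih =>
    exact det3_pos_trans hvinf (hv i (by omega)) (hv j (by omega)) (hv _ hj.le)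
      (ih (by omega)) (h.v_lt_v_succ hn hv₀ hvinf hy j hj)

/-- The centre f_n lies on the line from v_{n-1} to v∞. Only the ray of v_n is that of v∞; its
length depends on the earlier choices, and f₀ has to compensate for it. -/
theorem exists_v_last (h : IsPolygonConstruction n v₀ vinf y x v f) (hn : 2 ≤ n)
    (hv₀ : v₀ ∈ LightPlus) (hvinf : vinf ∈ LightPlus)
    (hy : ∀ i, 1 ≤ i → i < n → y i ∈ LightPlus) : ∃ c : ℚ, 0 < c ∧ v n = c • vinf := by
  obtain ⟨m, rfl⟩ := Nat.exists_eq_add_of_le' (show 1 ≤ n by omega)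
  obtain ⟨s, t, hs, ht, hf⟩ := h.f_last.2
  have hv := h.v_light hv₀
  have h0 : 0 < det3 (v 0) (v m) vinf := by
    rw [det3_rotate]
    exact h.v_lt_v hn hv₀ hvinf hy 0 m (by omega) (by omega)
  have h1 : form (v m) vinf < 0 := by
    rw [← det3_rotate] at h0
    exact form_neg_of_det3_ne_zero (hv m (by omega)) hvinf (hv 0 (by omega)) h0.ne'
  refine ⟨t / s, by positivity, ?_⟩
  rw [h.v_succ m (by omega), hf]
  exact rot_line_left (hv m (by omega)).1 hvinf.1 h1.ne hs.ne' ht.ne'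

theorem det3_pos (h : IsPolygonConstruction n v₀ vinf y x v f) (hn : 2 ≤ n)
    (hv₀ : v₀ ∈ LightPlus) (hvinf : vinf ∈ LightPlus)
    (hy : ∀ i, 1 ≤ i → i < n → y i ∈ LightPlus) (i j k : ℕ) (hij : i < j) (hjk : j < k)
    (hk : k ≤ n) : 0 < det3 (v i) (v j) (v k) := by
  have hv := h.v_light hv₀
  rcases hk.lt_or_eq with hk | rfl
  · exact det3_pos_of_trans hvinf (hv i (by omega)) (hv j (by omega)) (hv k hk.le)
      (h.v_lt_v hn hv₀ hvinf hy i j hij (by omega)) (h.v_lt_v hn hv₀ hvinf hy j k hjk hk)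
  · obtain ⟨c, hc, e⟩ := h.exists_v_last hn hv₀ hvinf hy
    rw [e, det3_smul_right, det3_rotate]
    exact mul_pos hc (h.v_lt_v hn hv₀ hvinf hy i j hij hjk)

theorem form_neg (h : IsPolygonConstruction n v₀ vinf y x v f) (hn : 2 ≤ n)
    (hv₀ : v₀ ∈ LightPlus) (hvinf : vinf ∈ LightPlus)
    (hy : ∀ i, 1 ≤ i → i < n → y i ∈ LightPlus) (i j : ℕ) (hij : i < j) (hj : j ≤ n) :
    form (v i) (v j) < 0 := by
  have hv := h.v_light hv₀
  have hp := h.det3_pos hn hv₀ hvinf hy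
  by_cases hj' : j = n
  · by_cases hi : i = 0
    · have := hp 0 1 n (by omega) (by omega) le_rfl
      rw [← det3_rotate, ← det3_rotate] at this
      rw [hi, hj', form_comm]
      exact form_neg_of_det3_ne_zero (hv _ le_rfl) (hv _ (by omega)) (hv 1 (by omega)) this.ne'
    · have := hp 0 i j (by omega) (by omega) hj
      rw [← det3_rotate] at this
      exact form_neg_of_det3_ne_zero (hv _ (by omega)) (hv _ hj) (hv 0 (by omega)) this.ne'
  · exact form_neg_of_det3_ne_zero (hv _ (by omega)) (hv _ hj) (hv n le_rfl)
      (hp i j n hij (by omega) le_rfl).ne'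

/-- The weights of v_n and v₀ in f₀ are equal, so the vectors are exchanged without rescaling. This
is the completeness condition at the cusp. -/
theorem rot_f_zero (h : IsPolygonConstruction n v₀ vinf y x v f) (hn : 2 ≤ n)
    (hv₀ : v₀ ∈ LightPlus) (hvinf : vinf ∈ LightPlus)
    (hy : ∀ i, 1 ≤ i → i < n → y i ∈ LightPlus) : rot (f 0) (v n) = v 0 := by
  have hv := h.v_light hv₀
  obtain ⟨c, hc⟩ := h.f_zero
  have hc0 : c ≠ 0 := by
    rintro rfl
    have := (h.f_mem 0 (by omega)).2
    rw [hc] at this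
    simp at this
  have hn := h.form_neg hn hv₀ hvinf hy 0 n (by omega) le_rfl
  rw [hc, smul_add, ← h.v_zero, rot_line_left (hv n le_rfl).1 (hv 0 (by omega)).1
    (by rw [form_comm]; exact hn.ne) hc0 hc0, div_self hc0, one_smul]

/-- The polygon construction yields an ideal polygon with the vertices `v₀, …, v_n`. -/
theorem isIdealPolygon (h : IsPolygonConstruction n v₀ vinf y x v f) (hn : 2 ≤ n)
    (hv₀ : v₀ ∈ LightPlus) (hvinf : vinf ∈ LightPlus)
    (hy : ∀ i, 1 ≤ i → i < n → y i ∈ LightPlus) :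
    IsIdealPolygon (fun i : Fin (n + 1) => v i) (fun i => i - 1) (fun i => f i) := by
  have hv := h.v_light hv₀
  have hp := h.det3_pos hn hv₀ hvinf hy
  -- Subtraction in `Fin (n + 1)` is cyclic: the vertex before v₀ is v_n, and the side with index 0
  -- closes the polygon.
  have hsub (i : Fin (n + 1)) : ((i - 1 : Fin (n + 1)) : ℕ) = if i = 0 then n else (i : ℕ) - 1 :=
    Fin.coe_sub_one i
  have hz (i : Fin (n + 1)) : i = 0 ↔ (i : ℕ) = 0 := by rw [Fin.ext_iff]; rfl
  have hneg : ∀ i j : Fin (n + 1), i ≠ j → form (v i) (v j) < 0 := by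
    intro i j hij
    rcases lt_or_gt_of_ne (fun e => hij (Fin.ext e) : (i : ℕ) ≠ j) with h1 | h1
    · exact h.form_neg hn hv₀ hvinf hy i j h1 (by omega)
    · rw [form_comm]; exact h.form_neg hn hv₀ hvinf hy j i h1 (by omega)
  refine ⟨fun i => hv i (by omega), fun i => h.f_mem i (by omega), ?_, ?_, ?_, hneg, ?_⟩
  · intro i
    have hi := i.is_lt
    rw [hsub]
    split_ifs with h0
    · rw [h0]; exact h.rot_f_zero hn hv₀ hvinf hy
    · rw [hz] at h0
      obtain ⟨k, hk⟩ := Nat.exists_eq_add_of_le' (show 1 ≤ (i : ℕ) by omega)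
      rw [hk, Nat.add_sub_cancel, h.v_succ k (by omega)]
  · intro i e
    have := congrArg Fin.val e
    rw [hsub] at this
    split_ifs at this with h0 <;> rw [hz] at h0 <;> omega
  · intro i e
    have := congrArg Fin.val e
    have hi := i.is_lt
    simp only [hz, hsub] at this
    split_ifs at this <;> omega
  · intro i j hij hij'
    have hi := i.is_lt
    have hj := j.is_lt
    have h1 : (i : ℕ) ≠ j := fun e => hij (Fin.ext e)
    have h2 : (i : ℕ) ≠ (j - 1 : Fin (n + 1)) := fun e => hij' (Fin.ext e)
    rw [hsub] at h2 ⊢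
    split_ifs at h2 ⊢ with h0 <;> rw [hz] at h0
    · rw [← det3_rotate, h0]
      exact hp _ _ _ (by omega) (by omega) le_rfl
    · rcases lt_or_gt_of_ne h1 with h3 | h3
      · rw [← det3_rotate, ← det3_rotate]
        exact hp _ _ _ (by omega) (by omega) (by omega)
      · exact hp _ _ _ (by omega) (by omega) (by omega)

/-- For `1 ≤ i < n` the points `f_i` and `f_{i+1}` are on the line from `x_i` to `y_i`. -/
theorem f_mem_line (h : IsPolygonConstruction n v₀ vinf y x v f)
    (hy : ∀ i, 1 ≤ i → i < n → y i ∈ LightPlus) (i : ℕ) (h1 : 1 ≤ i) (hi : i < n) :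
    f i ∈ line (x i) (y i) ∧ f (i + 1) ∈ line (x i) (y i) := by
  constructor
  · obtain ⟨i, rfl⟩ := Nat.exists_eq_add_of_le' h1
    rcases Nat.eq_zero_or_pos i with rfl | hi0
    · exact h.f_one
    · have hf := h.f_mem _ hi.le
      have hneg := form_neg_of_light_time (hy _ h1 hi) hf
      -- Since x = ρ_f(y), the sum x + y is the multiple 2⟨y, f⟩/⟨f, f⟩ of f; the inverse of this
      -- factor is the weight of both ends.
      have hc : 0 < form (f (i + 1)) (f (i + 1)) / (2 * form (y (i + 1)) (f (i + 1))) :=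
        div_pos_of_neg_of_neg hf.1 (by linarith)
      refine ⟨_, _, hc, hc, ?_⟩
      rw [h.x_succ i hi0 hi, ← smul_add, rot, sub_add_cancel, smul_smul, div_mul_div_cancel₀,
        div_self hf.1.ne, one_smul]
      linarith
  · by_cases hi' : i + 1 < n
    · exact h.f_succ i h1 hi'
    · obtain rfl : n = i + 1 := by omega
      exact h.f_last.1

end IsPolygonConstruction

/-! ### Existence of the construction -/

/-- The step of the construction: a rotation about a point of the line from `x` to `y` which maps
`y'` into the arc from `v` to `y`, and hence `v` into the arc from `y` to `y'`. -/
theorem exists_step {p x v y y' : Mink} (hp : p ∈ LightPlus) (hx : x ∈ LightPlus)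
    (hv : v ∈ LightPlus) (hy : y ∈ LightPlus) (hy' : y' ∈ LightPlus) (hxv : 0 < det3 p x v)
    (hvy : 0 < det3 p v y) (hyy' : 0 < det3 p y y') :
    ∃ f, f ∈ line x y ∧ f ∈ TimePlus ∧ 0 < det3 p v (rot f y') ∧ 0 < det3 p (rot f y') y ∧
      0 < det3 p y (rot f v) ∧ 0 < det3 p (rot f v) y' := by
  -- Any rational point w between v and y would do; this one is the image of p under the half-turn
  -- about v + y.
  obtain ⟨hw, hvw, hwy⟩ := rot_between (f := v + y) hp hv hy hvy
    ⟨1, 1, one_pos, one_pos, by simp⟩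
  set w := rot (v + y) p
  have hxw := det3_pos_trans hp hx hv hw hxv hvw
  have hxy := det3_pos_trans hp hx hw hy hxw hwy
  have hwy' := det3_pos_trans hp hw hy hy' hwy hyy'
  have d1 := det3_pos_of_trans hp hw hy hy' hwy hyy'
  have d2 := det3_pos_of_trans hp hx hw hy' hxw hwy'
  have d3 := det3_pos_of_trans hp hx hy hy' hxy hyy'
  have d4 := det3_pos_of_trans hp hx hw hy hxw hwy
  have d5 := det3_pos_of_trans hp hx hv hw hxv hvw
  -- With f on the lines x y and w y', the half-turn exchanges x with y and w with y'. It maps x < v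
  -- < w to y < ρ(v) < y'.
  obtain ⟨f, hf1, hf2⟩ := exists_crossing d1 d2 d3 d4
  obtain ⟨s, t, hs, ht, e1⟩ := hf1
  obtain ⟨c, d, hc, hd, e2⟩ := hf2
  have hxyn : form x y < 0 := form_neg_of_det3_ne_zero hx hy hy' d3.ne'
  have hwyn : form w y' < 0 := by
    rw [← det3_rotate] at d2; exact form_neg_of_det3_ne_zero hw hy' hx d2.ne'
  have hfT : f ∈ TimePlus := e1 ▸ time_of_line hx hy hxyn hs ht
  have r1 : rot f y' = (c / d) • w := by
    rw [e2]; exact rot_line_right hw.1 hy'.1 hwyn.ne hc.ne' hd.ne'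
  have r2 : rot f w = (d / c) • y' := by
    rw [e2]; exact rot_line_left hw.1 hy'.1 hwyn.ne hc.ne' hd.ne'
  have r3 : rot f x = (t / s) • y := by
    rw [e1]; exact rot_line_left hx.1 hy.1 hxyn.ne hs.ne' ht.ne'
  have hv' := light_rot hv hfT
  have d6 : 0 < det3 y (rot f v) y' := by
    have h := det3_rot (time_form_ne hfT) x v w
    rw [r3, r2, det3_smul_left, det3_smul_right] at h
    rw [← h] at d5
    exact pos_of_mul_pos_right (pos_of_mul_pos_right d5 (by positivity)) (by positivity)
  obtain ⟨d7, d8⟩ := between_of_det3 hp hy hy' hv' hyy' d6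
  refine ⟨f, ⟨s, t, hs, ht, e1⟩, hfT, ?_, ?_, d7, d8⟩
  · rw [r1, det3_smul_right]; positivity
  · rw [r1, det3_smul_mid]; positivity

/-- The polygon construction is possible with any choice of `x₁` between `v₀` and `y₁`. -/
theorem exists_polygonConstruction {n : ℕ} (hn : 2 ≤ n) {v₀ vinf x₁ : Mink} {y : ℕ → Mink}
    (hv₀ : v₀ ∈ LightPlus) (hvinf : vinf ∈ LightPlus)
    (hy : ∀ i, 1 ≤ i → i < n → y i ∈ LightPlus)
    (hyy : ∀ i, 1 ≤ i → i + 1 < n → BLt vinf (y i) (y (i + 1)))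
    (hx₁ : x₁ ∈ LightPlus) (hvx : BLt vinf v₀ x₁) (hxy : BLt vinf x₁ (y 1)) :
    ∃ x v f : ℕ → Mink, IsPolygonConstruction n v₀ vinf y x v f ∧ x 1 = x₁ := by
  -- The hypotheses stand under the existential quantifier so that `choose` gives a total function
  -- for the recursion; the value 0 is a default.
  have hstep : ∀ x v y y' : Mink, ∃ f, x ∈ LightPlus → v ∈ LightPlus → y ∈ LightPlus →
      y' ∈ LightPlus → 0 < det3 vinf x v → 0 < det3 vinf v y → 0 < det3 vinf y y' →
      f ∈ line x y ∧ f ∈ TimePlus ∧ 0 < det3 vinf v (rot f y') ∧ 0 < det3 vinf (rot f y') y ∧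
        0 < det3 vinf y (rot f v) ∧ 0 < det3 vinf (rot f v) y' := by
    intro x v y y'
    by_cases h : x ∈ LightPlus ∧ v ∈ LightPlus ∧ y ∈ LightPlus ∧ y' ∈ LightPlus ∧
      0 < det3 vinf x v ∧ 0 < det3 vinf v y ∧ 0 < det3 vinf y y'
    · obtain ⟨f, hf⟩ := exists_step hvinf h.1 h.2.1 h.2.2.1 h.2.2.2.1 h.2.2.2.2.1 h.2.2.2.2.2.1
        h.2.2.2.2.2.2
      exact ⟨f, fun _ _ _ _ _ _ _ => hf⟩
    · exact ⟨0, fun h1 h2 h3 h4 h5 h6 h7 => (h ⟨h1, h2, h3, h4, h5, h6, h7⟩).elim⟩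
  choose F hF using hstep
  have hy1 := hy 1 le_rfl hn
  rw [BLt_iff] at hvx hxy
  have hf1 : x₁ + y 1 ∈ line x₁ (y 1) := ⟨1, 1, one_pos, one_pos, by simp⟩
  have hn1 : form x₁ (y 1) < 0 := by
    rw [← det3_rotate] at hxy; exact form_neg_of_det3_ne_zero hx₁ hy1 hvinf hxy.ne'
  have hf1T : x₁ + y 1 ∈ TimePlus := by
    simpa using time_of_line hx₁ hy1 hn1 one_pos one_pos
  -- the states `(x, v, f)` after the steps `1, 2, …`
  let S : ℕ → Mink × Mink × Mink := fun k => Nat.rec (x₁, rot (x₁ + y 1) v₀, x₁ + y 1)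
    (fun k s => (rot (F s.1 s.2.1 (y (k + 1)) (y (k + 2))) (y (k + 2)),
      rot (F s.1 s.2.1 (y (k + 1)) (y (k + 2))) s.2.1, F s.1 s.2.1 (y (k + 1)) (y (k + 2)))) k
  have hS0 : S 0 = (x₁, rot (x₁ + y 1) v₀, x₁ + y 1) := rfl
  have hSf (k : ℕ) : (S (k + 1)).2.2 = F (S k).1 (S k).2.1 (y (k + 1)) (y (k + 2)) := rfl
  have hSx (k : ℕ) : (S (k + 1)).1 = rot (S (k + 1)).2.2 (y (k + 2)) := rfl
  have hSv (k : ℕ) : (S (k + 1)).2.1 = rot (S (k + 1)).2.2 (S k).2.1 := rfl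
  -- `S k` is the state after step k + 1. The invariant x_{k+1} < v_{k+1} < y_{k+1} is what
  -- `exists_step` needs for the next step.
  have inv : ∀ k, k + 1 < n → (S k).1 ∈ LightPlus ∧ (S k).2.1 ∈ LightPlus ∧
      (S k).2.2 ∈ TimePlus ∧
      0 < det3 vinf (S k).1 (S k).2.1 ∧ 0 < det3 vinf (S k).2.1 (y (k + 1)) := by
    intro k
    induction k with
    | zero =>
      intro _
      have h3 := det3_pos_of_trans hvinf hv₀ hx₁ hy1 hvx hxy
      obtain ⟨h4, h5, h6⟩ := rot_between hv₀ hx₁ hy1 h3 hf1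
      have h7 := det3_pos_of_trans hv₀ hx₁ h4 hy1 h5 h6
      exact ⟨hx₁, h4, hf1T, between_of_det3 hvinf hx₁ hy1 h4 hxy h7⟩
    | succ k ih =>
      intro hk
      obtain ⟨h1, h2, h2', h3, h4⟩ := ih (by omega)
      have hyk := hy (k + 1) (by omega) (by omega)
      have hyk' := hy (k + 2) (by omega) (by omega)
      obtain ⟨g1, g2, g3, g4, g5, g6⟩ := hF _ _ _ _ h1 h2 hyk hyk' h3 h4
        (BLt_iff.mp (hyy (k + 1) (by omega) hk))
      rw [hSx, hSv, hSf]
      exact ⟨light_rot hyk' g2, light_rot h2 g2, g2,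
        det3_pos_trans hvinf (light_rot hyk' g2) hyk (light_rot h2 g2) g4 g5, g6⟩
  have hstep : ∀ k, k + 2 < n → (S (k + 1)).2.2 ∈ line (S k).1 (y (k + 1)) ∧
      0 < det3 vinf (S k).2.1 (S (k + 1)).1 ∧ 0 < det3 vinf (S (k + 1)).1 (y (k + 1)) ∧
        0 < det3 vinf (y (k + 1)) (S (k + 1)).2.1 ∧
        0 < det3 vinf (S (k + 1)).2.1 (y (k + 2)) := by
    intro k hk
    obtain ⟨h1, h2, h2', h3, h4⟩ := inv k (by omega)
    have hyk := hy (k + 1) (by omega) (by omega)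
    have hyk' := hy (k + 2) (by omega) (by omega)
    obtain ⟨g1, g2, g3⟩ := hF _ _ _ _ h1 h2 hyk hyk' h3 h4
      (BLt_iff.mp (hyy (k + 1) (by omega) hk))
    exact ⟨g1, g3⟩
  -- the last two steps
  obtain ⟨m, rfl⟩ := Nat.exists_eq_add_of_le' hn
  obtain ⟨hxm, hvm, -, h1, h2⟩ := inv m (by omega)
  have hym := hy (m + 1) (by omega) (by omega)
  have h3 := det3_pos_trans hvinf hxm hvm hym h1 h2
  have h4 := det3_pos_of_trans hvinf hxm hvm hym h1 h2
  obtain ⟨g, hg1, hg2⟩ := exists_crossing (x := (S m).1) (w := (S m).2.1) (y := y (m + 1))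
    (q := vinf) (by rwa [det3_rotate]) (by rwa [det3_rotate]) (by rwa [det3_rotate]) h4
  have hgT : g ∈ TimePlus := by
    obtain ⟨s, t, hs, ht, rfl⟩ := hg1
    refine time_of_line hxm hym ?_ hs ht
    rw [← det3_rotate] at h3
    exact form_neg_of_det3_ne_zero hxm hym hvinf h3.ne'
  have hvn := light_rot hvm hgT
  have hT0 : rot g (S m).2.1 + v₀ ∈ TimePlus := by
    have key : form vinf v₀ < 0 := form_neg_of_det3_ne_zero hvinf hv₀ hx₁ hvx.ne'
    have key2 : form (S m).2.1 vinf < 0 := by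
      rw [form_comm]; exact form_neg_of_det3_ne_zero hvinf hvm hym h2.ne'
    obtain ⟨s, t, hs, ht, e⟩ := hg2
    rw [e, rot_line_left hvm.1 hvinf.1 key2.ne hs.ne' ht.ne']
    simpa using time_of_line hvinf hv₀ key (div_pos ht hs) one_pos
  refine ⟨fun i => (S (i - 1)).1,
    fun i => if i = 0 then v₀ else if i = m + 2 then rot g (S m).2.1 else (S (i - 1)).2.1,
    fun i => if i = 0 then rot g (S m).2.1 + v₀ else if i = m + 2 then g else (S (i - 1)).2.2,
    ?_, rfl⟩
  refine ⟨?_, ?_, ?_, ?_, ?_, ?_, ?_, ?_, ?_, ?_, ?_, ?_⟩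
  · intro i hi
    split_ifs with c1 c2
    · exact hT0
    · exact hgT
    · exact (inv (i - 1) (by omega)).2.2.1
  · simp
  · intro i hi
    rcases Nat.eq_zero_or_pos i with rfl | hi0
    · simp [hS0]
    · obtain ⟨k, rfl⟩ := Nat.exists_eq_add_of_le' hi0
      by_cases hk : k = m
      · subst hk; simp
      · have : k ≠ m + 1 := by have := hi; omega
        simp [hk, hSv, this]
  · exact hx₁
  · exact BLt_iff.mpr hvx
  · exact BLt_iff.mpr hxy
  · simpa [hS0] using hf1
  · intro i hi0 hi
    obtain ⟨k, rfl⟩ := Nat.exists_eq_add_of_le' hi0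
    have : k ≠ m := by omega
    simpa [this] using (hstep k (by omega)).1
  · intro i hi0 hi
    obtain ⟨k, rfl⟩ := Nat.exists_eq_add_of_le' hi0
    have : k ≠ m := by omega
    simp [this, hSx]
  · intro i hi0 hi
    obtain ⟨k, rfl⟩ := Nat.exists_eq_add_of_le' hi0
    have h1 : k ≠ m := by omega
    have h2 : k ≠ m + 1 := by omega
    simpa [h1, h2, BLt_iff] using (hstep k (by omega)).2
  · simpa using ⟨hg1, hg2⟩
  · exact ⟨1, by simp⟩

/-! ### The pairing of Minkowski space with the upper half-plane -/

/-- The pairing of a vector with a point of the upper half-plane. Up to a negative factor it is the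
Lorentz form with the point of the hyperboloid that corresponds to the point of `ℍ`. -/
def ht (v : Mink) (z : ℍ) : ℝ :=
  (((v 0 : ℝ) - v 2) * (z.re ^ 2 + z.im ^ 2) - 2 * v 1 * z.re + ((v 0 : ℝ) + v 2)) / z.im

theorem ht_add (u v : Mink) (z : ℍ) : ht (u + v) z = ht u z + ht v z := by
  simp only [ht, Pi.add_apply, Rat.cast_add]; ring

theorem ht_smul (c : ℚ) (v : Mink) (z : ℍ) : ht (c • v) z = c * ht v z := by
  simp only [ht, Pi.smul_apply, smul_eq_mul, Rat.cast_mul]; ring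

theorem ht_neg (v : Mink) (z : ℍ) : ht (-v) z = -ht v z := by
  rw [← neg_one_smul ℚ v, ht_smul]; simp

@[fun_prop]
theorem continuous_ht (v : Mink) : Continuous (ht v) := by
  unfold ht
  have h1 : Continuous fun z : ℍ => z.re := UpperHalfPlane.continuous_re
  have h2 : Continuous fun z : ℍ => z.im := UpperHalfPlane.continuous_im
  exact Continuous.div₀ (by fun_prop) h2 fun z => z.im_pos.ne'

/-- A light-like vector corresponds to the square of a linear form. -/
theorem exists_light_param {v : Mink} (hv : v ∈ LightPlus) : ∃ a c : ℝ,
    ((v 0 : ℝ) - v 2) = a ^ 2 ∧ (v 1 : ℝ) = a * c ∧ ((v 0 : ℝ) + v 2) = c ^ 2 ∧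
      (a ≠ 0 ∨ c ≠ 0) := by
  obtain ⟨h1, h2⟩ := hv
  simp only [form] at h1
  have h1' : (v 1 : ℝ) * v 1 + v 2 * v 2 - v 0 * v 0 = 0 := by exact_mod_cast h1
  have h2' : (0 : ℝ) < v 0 := by exact_mod_cast h2
  have hab := abs_le_of_sq_le_sq' (show (v 2 : ℝ) ^ 2 ≤ (v 0 : ℝ) ^ 2 by
    nlinarith [mul_self_nonneg (v 1 : ℝ)]) h2'.le
  have hp : 0 ≤ (v 0 : ℝ) - v 2 := by linarith [hab.2]
  have hq : 0 ≤ (v 0 : ℝ) + v 2 := by linarith [hab.1]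
  have hne : √((v 0 : ℝ) - v 2) ≠ 0 ∨ √((v 0 : ℝ) + v 2) ≠ 0 := by
    by_contra hcon
    push Not at hcon
    rw [Real.sqrt_eq_zero hp, Real.sqrt_eq_zero hq] at hcon
    linarith [hcon.1, hcon.2]
  have hm : (√((v 0 : ℝ) - v 2) * √((v 0 : ℝ) + v 2)) ^ 2 = (v 1 : ℝ) ^ 2 := by
    rw [mul_pow, Real.sq_sqrt hp, Real.sq_sqrt hq]; linarith
  rcases sq_eq_sq_iff_eq_or_eq_neg.mp hm with h | h
  · exact ⟨_, _, (Real.sq_sqrt hp).symm, h.symm, (Real.sq_sqrt hq).symm, hne⟩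
  · exact ⟨√((v 0 : ℝ) - v 2), -√((v 0 : ℝ) + v 2), (Real.sq_sqrt hp).symm, by linarith,
      by rw [neg_sq, Real.sq_sqrt hq], by simpa using hne⟩

theorem ht_of_param {v : Mink} {a c : ℝ} (h1 : ((v 0 : ℝ) - v 2) = a ^ 2)
    (h2 : (v 1 : ℝ) = a * c) (h3 : ((v 0 : ℝ) + v 2) = c ^ 2) (z : ℍ) :
    ht v z = ((a * z.re - c) ^ 2 + (a * z.im) ^ 2) / z.im := by
  rw [ht, h1, h2, h3]; ring

theorem ht_pos {v : Mink} (hv : v ∈ LightPlus) (z : ℍ) : 0 < ht v z := by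
  obtain ⟨a, c, h1, h2, h3, h4⟩ := exists_light_param hv
  rw [ht_of_param h1 h2 h3]
  refine div_pos ?_ z.im_pos
  by_cases ha : a = 0
  · have hc : c ≠ 0 := h4.resolve_left (not_not.mpr ha)
    subst ha; simp only [zero_mul, zero_sub, neg_sq]; positivity
  · have := z.im_pos
    positivity

/-- For the linear forms ℓ, ℓ' of `u`, `v` the right side is |ℓ(z)|²|ℓ'(z)|²/y², while the left side
keeps only the square of the imaginary part of ℓ(z) times the conjugate of ℓ'(z). Consequently small
horodiscs at distinct cusps are disjoint. -/
theorem le_ht_mul_ht {u v : Mink} (hu : u ∈ LightPlus) (hv : v ∈ LightPlus) (z : ℍ) :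
    -2 * (form u v : ℝ) ≤ ht u z * ht v z := by
  obtain ⟨a, c, h1, h2, h3, -⟩ := exists_light_param hu
  obtain ⟨a', c', h1', h2', h3', -⟩ := exists_light_param hv
  have hf : -2 * (form u v : ℝ) = (a * c' - a' * c) ^ 2 := by
    simp only [form]; push_cast
    have e1 : (u 0 : ℝ) = (a ^ 2 + c ^ 2) / 2 := by linarith
    have e2 : (u 2 : ℝ) = (c ^ 2 - a ^ 2) / 2 := by linarith
    have e3 : (v 0 : ℝ) = (a' ^ 2 + c' ^ 2) / 2 := by linarith
    have e4 : (v 2 : ℝ) = (c' ^ 2 - a' ^ 2) / 2 := by linarith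
    rw [e1, e2, e3, e4, h2, h2']; ring
  rw [hf, ht_of_param h1 h2 h3, ht_of_param h1' h2' h3', div_mul_div_comm,
    le_div_iff₀ (mul_pos z.im_pos z.im_pos)]
  nlinarith [sq_nonneg ((a * z.re - c) * (a' * z.re - c') + a * z.im * (a' * z.im))]

/-- Near a point, the pairing with light-like vectors does not drop by more than the factor `2`. -/
theorem eventually_half_ht_le (w : ℍ) :
    ∀ᶠ z in nhds w, ∀ v ∈ LightPlus, ht v w ≤ 2 * ht v z := by
  have hre : Filter.Tendsto (fun z : ℍ => z.re) (nhds w) (nhds w.re) :=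
    UpperHalfPlane.continuous_re.continuousAt
  have him : Filter.Tendsto (fun z : ℍ => z.im) (nhds w) (nhds w.im) :=
    UpperHalfPlane.continuous_im.continuousAt
  have hw := w.im_pos
  -- The tolerance 1/6 costs a factor 12/7 in the numerator and 7/6 in the height, with product 2.
  have h1 : ∀ᶠ z : ℍ in nhds w, (5 / 6) * w.im < z.im :=
    him.eventually (lt_mem_nhds (by linarith))
  have h2 : ∀ᶠ z : ℍ in nhds w, z.im < (7 / 6) * w.im :=
    him.eventually (gt_mem_nhds (by linarith))
  have h3 : ∀ᶠ z : ℍ in nhds w, w.re - w.im / 6 < z.re :=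
    hre.eventually (lt_mem_nhds (by linarith))
  have h4 : ∀ᶠ z : ℍ in nhds w, z.re < w.re + w.im / 6 :=
    hre.eventually (gt_mem_nhds (by linarith))
  filter_upwards [h1, h2, h3, h4] with z h1 h2 h3 h4 v hv
  obtain ⟨a, c, e1, e2, e3, -⟩ := exists_light_param hv
  rw [ht_of_param e1 e2 e3, ht_of_param e1 e2 e3, ← mul_div_assoc, div_le_div_iff₀ hw z.im_pos]
  have hd : (w.re - z.re) ^ 2 ≤ (w.im / 6) ^ 2 := by
    apply sq_le_sq' <;> linarith
  set p := a * z.re - c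
  set q := a * w.im
  have e : a * w.re - c = p + a * (w.re - z.re) := by simp only [p]; ring
  have hb : (a * (w.re - z.re)) ^ 2 ≤ q ^ 2 / 36 := by
    rw [mul_pow]
    calc a ^ 2 * (w.re - z.re) ^ 2 ≤ a ^ 2 * (w.im / 6) ^ 2 := by gcongr
      _ = q ^ 2 / 36 := by simp only [q]; ring
  have hc : (25 / 36) * q ^ 2 ≤ (a * z.im) ^ 2 := by
    simp only [q, mul_pow]
    have : ((5 / 6) * w.im) ^ 2 ≤ z.im ^ 2 := by gcongr
    nlinarith [sq_nonneg a]
  rw [e]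
  have key : (p + a * (w.re - z.re)) ^ 2 + q ^ 2 ≤ (12 / 7) * (p ^ 2 + (a * z.im) ^ 2) := by
    nlinarith [sq_nonneg ((5 / 7) * p - a * (w.re - z.re))]
  have hN : 0 ≤ p ^ 2 + (a * z.im) ^ 2 := by positivity
  calc ((p + a * (w.re - z.re)) ^ 2 + q ^ 2) * z.im
      ≤ ((12 / 7) * (p ^ 2 + (a * z.im) ^ 2)) * ((7 / 6) * w.im) := by gcongr
    _ = 2 * (p ^ 2 + (a * z.im) ^ 2) * w.im := by ring

/-! ### The action of `PGL(2, ℚ)` on the upper half-plane -/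

theorem re_smul_eq (g : GL (Fin 2) ℝ) (z : ℍ) :
    (g • z).re = ((g 0 0 * z.re + g 0 1) * (g 1 0 * z.re + g 1 1) + g 0 0 * g 1 0 * z.im ^ 2) /
      ((g 1 0 * z.re + g 1 1) ^ 2 + (g 1 0 * z.im) ^ 2) := by
  rw [UpperHalfPlane.re_smul]
  simp only [UpperHalfPlane.num, UpperHalfPlane.denom, Complex.div_re, Complex.normSq_apply,
    Complex.add_re, Complex.add_im, Complex.mul_re, Complex.mul_im, Complex.ofReal_re,
    Complex.ofReal_im, UpperHalfPlane.coe_re, UpperHalfPlane.coe_im]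
  rw [← add_div]
  congr 1 <;> ring

theorem im_smul_of_det_pos {g : GL (Fin 2) ℝ} (hg : 0 < g.det.val) (z : ℍ) :
    (g • z).im = (g 0 0 * g 1 1 - g 0 1 * g 1 0) * z.im /
      ((g 1 0 * z.re + g 1 1) ^ 2 + (g 1 0 * z.im) ^ 2) := by
  rw [UpperHalfPlane.im_smul_eq_div_normSq, abs_of_pos hg]
  simp only [UpperHalfPlane.denom, Complex.normSq_apply,
    Complex.add_re, Complex.add_im, Complex.mul_re, Complex.mul_im, Complex.ofReal_re,
    Complex.ofReal_im, UpperHalfPlane.coe_re, UpperHalfPlane.coe_im,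
    Matrix.GeneralLinearGroup.val_det_apply, Matrix.det_fin_two]
  congr 1; ring

/-- `PGL(2, ℚ)` acts on the upper half-plane. -/
instance pglRatAction : MulAction PGL(2, ℚ) ℍ :=
  MulAction.compHom ℍ (Matrix.ProjGenLinGroup.map (n := Fin 2) (algebraMap ℚ ℝ))

theorem pglRat_mk_smul (g : GL (Fin 2) ℚ) (z : ℍ) :
    Matrix.ProjGenLinGroup.mk g • z = Matrix.GeneralLinearGroup.map (algebraMap ℚ ℝ) g • z :=
  rfl

instance : ContinuousConstSMul PGL(2, ℚ) ℍ := by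
  refine ⟨fun g => ?_⟩
  induction g using Matrix.ProjGenLinGroup.induction_on with | mk g =>
  simp only [pglRat_mk_smul]
  exact continuous_const_smul _

instance : SMulInvariantMeasure PGL(2, ℚ) ℍ volume := by
  refine ⟨fun g s hs => ?_⟩
  induction g using Matrix.ProjGenLinGroup.induction_on with | mk g =>
  simp only [pglRat_mk_smul]
  exact SMulInvariantMeasure.measure_preimage_smul _ hs

instance : MeasurableConstSMul PGL(2, ℚ) ℍ :=
  ⟨fun g => (continuous_const_smul g).measurable⟩

/-- The link between the Möbius and the Lorentz action. The inverse expected on the right is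
invisible because a half-turn is an involution. -/
theorem ht_rotPGL_smul {f : Mink} (hf : f ∈ TimePlus) (v : Mink) (z : ℍ) :
    ht v (rotPGL f hf • z) = ht (rot f v) z := by
  rw [rotPGL, pglRat_mk_smul]
  set g := Matrix.GeneralLinearGroup.map (algebraMap ℚ ℝ)
    (Matrix.GeneralLinearGroup.mkOfDetNeZero (rotMatrix f)
      (by rw [rotMatrix_det]; exact neg_ne_zero.mpr hf.1.ne)) with hg
  have h00 : g 0 0 = -(f 1 : ℝ) := by
    simp [hg, rotMatrix, symMatrix, form, e, Matrix.GeneralLinearGroup.mkOfDetNeZero]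
  have h01 : g 0 1 = (f 2 : ℝ) + f 0 := by
    simp [hg, rotMatrix, symMatrix, form, e, Matrix.GeneralLinearGroup.mkOfDetNeZero, add_comm]
  have h10 : g 1 0 = (f 2 : ℝ) - f 0 := by
    simp [hg, rotMatrix, symMatrix, form, e, Matrix.GeneralLinearGroup.mkOfDetNeZero]
  have h11 : g 1 1 = (f 1 : ℝ) := by
    simp [hg, rotMatrix, symMatrix, form, e, Matrix.GeneralLinearGroup.mkOfDetNeZero]
  have hD : (0 : ℝ) < (f 0 : ℝ) ^ 2 - f 1 ^ 2 - f 2 ^ 2 := by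
    have := hf.1
    simp only [form] at this
    have : (f 1 : ℝ) * f 1 + f 2 * f 2 - f 0 * f 0 < 0 := by exact_mod_cast this
    linarith
  have hdet : 0 < g.det.val := by
    rw [Matrix.GeneralLinearGroup.val_det_apply, Matrix.det_fin_two, h00, h01, h10, h11]
    linarith
  have hre := re_smul_eq g z
  have him := im_smul_of_det_pos hdet z
  rw [h00, h01, h10, h11] at hre him
  have hy := z.im_pos
  have hN : 0 < (((f 2 : ℝ) - f 0) * z.re + f 1) ^ 2 + (((f 2 : ℝ) - f 0) * z.im) ^ 2 := by
    have : (f 2 : ℝ) - f 0 ≠ 0 := by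
      intro h0
      have : (f 2 : ℝ) = f 0 := by linarith
      rw [this] at hD
      nlinarith [sq_nonneg (f 1 : ℝ)]
    positivity
  have hF : (form f f : ℝ) = -((f 0 : ℝ) ^ 2 - f 1 ^ 2 - f 2 ^ 2) := by
    simp only [form]; push_cast; ring
  have hFv : (form v f : ℝ) = v 1 * f 1 + v 2 * f 2 - v 0 * f 0 := by
    simp only [form]; push_cast; ring
  have hr (i : Fin 3) : ((rot f v i : ℚ) : ℝ) =
      2 * (v 1 * f 1 + v 2 * f 2 - v 0 * f 0) / -((f 0 : ℝ) ^ 2 - f 1 ^ 2 - f 2 ^ 2) * f i - v i := by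
    rw [← hF, ← hFv]
    simp only [rot, Pi.sub_apply, Pi.smul_apply, smul_eq_mul]; push_cast; ring
  rw [ht, ht, hr, hr, hr, hre, him]
  set X := z.re
  set Y := z.im
  generalize (f 0 : ℝ) = f0 at *
  generalize (f 1 : ℝ) = f1 at *
  generalize (f 2 : ℝ) = f2 at *
  generalize (v 0 : ℝ) = v0 at *
  generalize (v 1 : ℝ) = v1 at *
  generalize (v 2 : ℝ) = v2 at *
  have e1 : (-f1 * f1 - (f2 + f0) * (f2 - f0)) = f0 ^ 2 - f1 ^ 2 - f2 ^ 2 := by ring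
  rw [e1]
  -- This is |gz|² = |numerator|²/|denominator|².
  have e2 : (((-f1 * X + (f2 + f0)) * ((f2 - f0) * X + f1) + -f1 * (f2 - f0) * Y ^ 2) /
      (((f2 - f0) * X + f1) ^ 2 + ((f2 - f0) * Y) ^ 2)) ^ 2 +
      ((f0 ^ 2 - f1 ^ 2 - f2 ^ 2) * Y / (((f2 - f0) * X + f1) ^ 2 + ((f2 - f0) * Y) ^ 2)) ^ 2 =
      ((f1 * X - (f2 + f0)) ^ 2 + f1 ^ 2 * Y ^ 2) /
        (((f2 - f0) * X + f1) ^ 2 + ((f2 - f0) * Y) ^ 2) := by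
    rw [div_pow, div_pow, ← add_div, div_eq_div_iff (by positivity) hN.ne']
    ring
  rw [e2]
  have hD' := hD.ne'
  have hN' := hN.ne'
  have hY' := hy.ne'
  rw [div_div_eq_mul_div]
  generalize hNN : ((f2 - f0) * X + f1) ^ 2 + ((f2 - f0) * Y) ^ 2 = N at *
  field_simp
  rw [← hNN]
  ring

theorem rotPGL_mul_self {f : Mink} (hf : f ∈ TimePlus) : rotPGL f hf * rotPGL f hf = 1 := by
  rw [rotPGL, ← map_mul, ← Matrix.ProjGenLinGroup.mk_scalar
    (Units.mk0 (form f f) (time_form_ne hf))]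
  congr 1
  ext i j
  have hr : rotMatrix f * rotMatrix f = form f f • (1 : Matrix (Fin 2) (Fin 2) ℚ) := by
    rw [rotMatrix, Matrix.mul_fin_two, Matrix.one_fin_two]
    ext i j
    fin_cases i <;> fin_cases j <;> simp [symMatrix, form, e] <;> ring
  have := congrFun (congrFun hr i) j
  rw [Matrix.GeneralLinearGroup.coe_mul]
  simp only [Matrix.GeneralLinearGroup.mkOfDetNeZero]
  simp [this, Matrix.one_apply, Matrix.diagonal_apply]

/-! ### Reduced words in involutions -/

/-- The elements given by reduced words in the `g i`, together with the first letter. -/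
inductive IsReducedWord {G ι : Type*} [Group G] (g : ι → G) : Option ι → G → Prop
  | one : IsReducedWord g none 1
  | cons {o : Option ι} {γ : G} (i : ι) (h : IsReducedWord g o γ) (ho : o ≠ some i) :
    IsReducedWord g (some i) (g i * γ)

/-- Multiplication by a generator on the left either cancels the first letter or prepends a new one.
-/
theorem exists_isReducedWord {G ι : Type*} [Group G] {g : ι → G} (hg : ∀ i, g i * g i = 1)
    {γ : G} (hγ : γ ∈ Subgroup.closure (Set.range g)) : ∃ o, IsReducedWord g o γ := by
  have hmul : ∀ (i : ι) (γ : G), (∃ o, IsReducedWord g o γ) →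
      ∃ o, IsReducedWord g o (g i * γ) := by
    rintro i γ ⟨o, ho⟩
    by_cases hi : o = some i
    · cases ho with
      | one => simp at hi
      | cons j h hj =>
        obtain rfl : j = i := by simpa using hi
        rw [← mul_assoc, hg, one_mul]
        exact ⟨_, h⟩
    · exact ⟨_, ho.cons i hi⟩
  induction hγ using Subgroup.closure_induction_left with
  | one => exact ⟨_, .one⟩
  | mul_left x hx y hy ih =>
    obtain ⟨i, rfl⟩ := hx
    exact hmul i y ih
  | inv_mul_cancel x hx y hy ih =>
    obtain ⟨i, rfl⟩ := hx
    rw [inv_eq_of_mul_eq_one_left (hg i)]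
    exact hmul i y ih

/-! ### The geometry of ideal polygons -/

/-- The arithmetic-geometric inequality combined with `le_ht_mul_ht`; the constant is not sharp. -/
theorem exists_le_ht_add_ht {a b : Mink} (ha : a ∈ LightPlus) (hb : b ∈ LightPlus)
    (hab : form a b < 0) {p q : ℚ} (hp : 0 < p) (hq : 0 < q) :
    ∃ c : ℝ, 0 < c ∧ ∀ z, c ≤ p * ht a z + q * ht b z := by
  have hp' : (0 : ℝ) < p := by exact_mod_cast hp
  have hq' : (0 : ℝ) < q := by exact_mod_cast hq
  have hab' : (form a b : ℝ) < 0 := by exact_mod_cast hab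
  have hpq := mul_pos hp' hq'
  refine ⟨√(p * q * -(form a b : ℝ)), Real.sqrt_pos.mpr (mul_pos hpq (by linarith)), fun z => ?_⟩
  have h1 := ht_pos ha z
  have h2 := ht_pos hb z
  apply Real.sqrt_le_iff.mpr ⟨by positivity, ?_⟩
  nlinarith [mul_le_mul_of_nonneg_left (le_ht_mul_ht ha hb z) hpq.le,
    sq_nonneg (p * ht a z - q * ht b z), mul_pos hpq (neg_pos.mpr hab')]

theorem exists_pos_le_of_finite {κ : Type*} [Finite κ] (C : κ → ℝ) (hC : ∀ i, 0 < C i) :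
    ∃ c : ℝ, 0 < c ∧ ∀ i, c ≤ C i := by
  rcases isEmpty_or_nonempty κ with h | h
  · exact ⟨1, one_pos, fun i => h.elim i⟩
  · obtain ⟨i, hi⟩ := Finite.exists_min C
    exact ⟨C i, hC i, hi⟩

/-- The unit normal vector of the side of a polygon from `V (prev j)` to `V j`. It pairs
positively with the points on the same side as the polygon. -/
def side {ι : Type*} (V : ι → Mink) (prev : ι → ι) (j : ι) : Mink :=
  (form (V (prev j)) (V j))⁻¹ • cross (V (prev j)) (V j)

namespace IsIdealPolygon

variable {ι : Type*} {V : ι → Mink} {prev : ι → ι} {f : ι → Mink}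

/-- The rotation about `f i`. -/
def gen (h : IsIdealPolygon V prev f) (i : ι) : PGL(2, ℚ) := rotPGL (f i) (h.time i)

/-- The group generated by the rotations. -/
def group (h : IsIdealPolygon V prev f) : Subgroup PGL(2, ℚ) :=
  Subgroup.closure (Set.range h.gen)

theorem gen_mem_group (h : IsIdealPolygon V prev f) (i : ι) : h.gen i ∈ h.group :=
  Subgroup.subset_closure ⟨i, rfl⟩

theorem ht_gen_smul (h : IsIdealPolygon V prev f) (i : ι) (v : Mink) (z : ℍ) :
    ht v (h.gen i • z) = ht (rot (f i) v) z :=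
  ht_rotPGL_smul _ _ _

theorem rot_vertex (h : IsIdealPolygon V prev f) (i : ι) : rot (f i) (V i) = V (prev i) := by
  rw [← h.rot_prev i, rot_rot (time_form_ne (h.time i))]

theorem rot_side (h : IsIdealPolygon V prev f) (i : ι) :
    rot (f i) (side V prev i) = -side V prev i := by
  rw [side, rot_smul, ← cross_rot (time_form_ne (h.time i)), h.rot_prev, h.rot_vertex,
    cross_swap, smul_neg]

theorem ht_side_gen_smul (h : IsIdealPolygon V prev f) (i : ι) (z : ℍ) :
    ht (side V prev i) (h.gen i • z) = -ht (side V prev i) z := by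
  rw [h.ht_gen_smul, h.rot_side, ht_neg]

/-- The coefficient of `V i` in `side i + side j`. -/
def coeff (V : ι → Mink) (prev : ι → ι) (i j : ι) : ℚ :=
  (form (V (prev i)) (V i))⁻¹ * (form (V i) (V j))⁻¹ * det3 (V (prev i)) (V i) (V j)

/-- Add and subtract the normal of the diagonal from `V i` to `V j`: by `cross_add_cross` at each of
its ends, only a multiple of that vertex is left. -/
theorem side_add_side (h : IsIdealPolygon V prev f) {i j : ι} (hij : i ≠ j) :
    side V prev i + side V prev j = coeff V prev i j • V i + coeff V prev j i • V j := by
  have key : ∀ i j, i ≠ j → side V prev i + (form (V i) (V j))⁻¹ • cross (V i) (V j) =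
      coeff V prev i j • V i := by
    intro i j hij
    have h1 := (h.form_neg _ _ (h.prev_ne i)).ne
    have h2 := (h.form_neg _ _ hij).ne
    have e := cross_add_cross (V (prev i)) (V i) (V j)
    rw [(h.light i).1, zero_smul, add_zero] at e
    rw [coeff, mul_smul, ← e, smul_add, smul_smul, smul_smul, mul_assoc, inv_mul_cancel₀ h2,
      mul_one, mul_right_comm, inv_mul_cancel₀ h1, one_mul, side]
  have h1 := key i j hij
  have h2 := key j i hij.symm
  rw [form_comm (V j), cross_swap (V i), smul_neg] at h2
  rw [← h1, ← h2]; abel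

theorem coeff_pos (h : IsIdealPolygon V prev f) {i j : ι} (hij : i ≠ j) (hj : j ≠ prev i) :
    0 < coeff V prev i j := by
  rw [coeff, ← mul_inv]
  exact mul_pos (inv_pos.mpr (mul_pos_of_neg_of_neg (h.form_neg _ _ (h.prev_ne i))
    (h.form_neg _ _ hij))) (h.det_pos _ _ hij.symm hj)

theorem coeff_prev (i : ι) : coeff V prev i (prev i) = 0 := by
  have : det3 (V (prev i)) (V i) (V (prev i)) = 0 := by simp only [det3]; ring
  rw [coeff, this, mul_zero]

/-- For adjacent sides one coefficient vanishes and the sum is a positive multiple of the common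
vertex. Otherwise both coefficients are positive and the sum is bounded below. This quantifies how
far apart two sides are. -/
theorem exists_le_ht_side_add_side (h : IsIdealPolygon V prev f) {i j : ι} (hij : i ≠ j) :
    ∃ c : ℝ, 0 < c ∧ ((∀ z, c ≤ ht (side V prev i + side V prev j) z) ∨
      ∃ k, (k = j ∨ k = prev j) ∧ ∀ z, c * ht (V k) z ≤ ht (side V prev i + side V prev j) z) := by
  simp only [h.side_add_side hij, ht_add, ht_smul]
  by_cases h1 : j = prev i
  · have h2 : i ≠ prev j := fun e => h.prev_prev_ne i (by rw [← h1, ← e])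
    refine ⟨coeff V prev j i, by exact_mod_cast h.coeff_pos hij.symm h2, .inr ⟨j, .inl rfl, ?_⟩⟩
    intro z
    have : coeff V prev i j = 0 := by rw [h1, coeff_prev]
    simp [this]
  · by_cases h2 : i = prev j
    · refine ⟨coeff V prev i j, by exact_mod_cast h.coeff_pos hij h1, .inr ⟨i, .inr h2, ?_⟩⟩
      intro z
      have : coeff V prev j i = 0 := by rw [h2, coeff_prev]
      simp [this]
    · obtain ⟨c, hc, h3⟩ := exists_le_ht_add_ht (h.light i) (h.light j) (h.form_neg _ _ hij)
        (h.coeff_pos hij h1) (h.coeff_pos hij.symm h2)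
      exact ⟨c, hc, .inl h3⟩

/-- So no point lies beyond two different sides: the disjointness that ping-pong needs. -/
theorem ht_side_add_pos (h : IsIdealPolygon V prev f) {i j : ι} (hij : i ≠ j) (z : ℍ) :
    0 < ht (side V prev i) z + ht (side V prev j) z := by
  rw [← ht_add]
  obtain ⟨c, hc, h1 | ⟨k, -, h1⟩⟩ := h.exists_le_ht_side_add_side hij
  · exact hc.trans_le (h1 z)
  · exact (mul_pos hc (ht_pos (h.light k) z)).trans_le (h1 z)

/-- The open polygon. -/
def openPolygon (V : ι → Mink) (prev : ι → ι) : Set ℍ := {z | ∀ i, 0 < ht (side V prev i) z}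

/-- The closed polygon. -/
def closedPolygon (V : ι → Mink) (prev : ι → ι) : Set ℍ := {z | ∀ i, 0 ≤ ht (side V prev i) z}

theorem gen_mul_self (h : IsIdealPolygon V prev f) (i : ι) : h.gen i * h.gen i = 1 :=
  rotPGL_mul_self _

/-- A nontrivial reduced word maps the open polygon beyond the side of its first letter. -/
theorem ht_side_neg_of_isReducedWord (h : IsIdealPolygon V prev f) {z : ℍ}
    (hz : z ∈ openPolygon V prev) {o : Option ι} {γ : PGL(2, ℚ)} (hγ : IsReducedWord h.gen o γ) :
    ∀ i, o = some i → ht (side V prev i) (γ • z) < 0 := by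
  induction hγ with
  | one => simp
  | @cons o γ i hγ ho ih =>
    intro j hj
    obtain rfl : i = j := by simpa using hj
    rw [mul_smul, h.ht_side_gen_smul, neg_neg_iff_pos]
    cases hγ with
    | one => rw [one_smul]; exact hz i
    | @cons _ γ k _ _ =>
      have hki : k ≠ i := by simpa using ho
      have := ih k rfl
      have := h.ht_side_add_pos hki ((h.gen k * γ) • z)
      linarith

/-- Distinct translates of the open polygon are disjoint. -/
theorem eq_one_of_smul_mem (h : IsIdealPolygon V prev f) {z : ℍ} {γ : PGL(2, ℚ)}
    (hγ : γ ∈ h.group) (hz : z ∈ openPolygon V prev) (hγz : γ • z ∈ openPolygon V prev) : γ = 1 := by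
  obtain ⟨o, ho⟩ := exists_isReducedWord h.gen_mul_self hγ
  cases o with
  | none => cases ho; rfl
  | some i => exact absurd (h.ht_side_neg_of_isReducedWord hz ho i rfl) (hγz i).not_gt

/-! ### The translates of the closed polygon cover the hyperbolic plane -/

theorem exists_vertex_gen_smul (h : IsIdealPolygon V prev f) {j k : ι}
    (hk : k = j ∨ k = prev j) : ∃ k', ∀ z, ht (V k') (h.gen j • z) = ht (V k) z := by
  rcases hk with rfl | rfl
  · exact ⟨prev k, fun z => by rw [h.ht_gen_smul, h.rot_prev]⟩
  · exact ⟨j, fun z => by rw [h.ht_gen_smul, h.rot_vertex]⟩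

/-- Horodiscs of a common small size at distinct vertices are disjoint, by `le_ht_mul_ht`. -/
theorem exists_eq_of_ht_lt [Finite ι] (h : IsIdealPolygon V prev f) :
    ∃ ε : ℝ, 0 < ε ∧ ∀ z i j, ht (V i) z < ε → ht (V j) z < ε → i = j := by
  classical
  obtain ⟨m, hm, hm'⟩ := exists_pos_le_of_finite
    (fun p : ι × ι => if p.1 = p.2 then 1 else -2 * (form (V p.1) (V p.2) : ℝ)) (by
      rintro ⟨i, j⟩
      split_ifs with hij
      · exact one_pos
      · have : (form (V i) (V j) : ℝ) < 0 := by exact_mod_cast h.form_neg i j hij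
        dsimp only; linarith)
  refine ⟨√m, Real.sqrt_pos.mpr hm, fun z i j hi hj => ?_⟩
  by_contra hij
  have h1 := hm' (i, j)
  rw [if_neg hij] at h1
  have h2 := le_ht_mul_ht (h.light i) (h.light j) z
  have h3 := mul_lt_mul'' hi hj (ht_pos (h.light i) z).le (ht_pos (h.light j) z).le
  rw [Real.mul_self_sqrt hm.le] at h3
  simp only at h1
  linarith

/-- If no translate is in the polygon, keep rotating about a side beyond which the current point
lies. The excess s beyond the side decreases, so its decrements tend to 0. By the gap between sides,
the points must then turn around a single cusp. The generators exchange vertex vectors exactly, so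
the height at this cusp is constant and bounds the decrements from below, a contradiction. -/
theorem exists_smul_mem_closedPolygon [Finite ι] (h : IsIdealPolygon V prev f) (z : ℍ) :
    ∃ γ ∈ h.group, γ • z ∈ closedPolygon V prev := by
  classical
  by_contra hcon
  have hcon' : ∀ γ : h.group, ∃ i, ht (side V prev i) (γ.1 • z) < 0 := by
    intro γ
    by_contra hγ
    push Not at hγ
    exact hcon ⟨γ.1, γ.2, hγ⟩
  choose I hI using hcon'
  have hgap : ∀ p : ι × ι, ∃ c : ℝ, 0 < c ∧ (p.1 ≠ p.2 →
      ((∀ z, c ≤ ht (side V prev p.1 + side V prev p.2) z) ∨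
      ∃ k, (k = p.2 ∨ k = prev p.2) ∧
        ∀ z, c * ht (V k) z ≤ ht (side V prev p.1 + side V prev p.2) z)) := by
    rintro ⟨i, j⟩
    by_cases hij : i = j
    · exact ⟨1, one_pos, fun e => (e hij).elim⟩
    · obtain ⟨c, hc, hc'⟩ := h.exists_le_ht_side_add_side hij
      exact ⟨c, hc, fun _ => hc'⟩
  choose C hC hC' using hgap
  obtain ⟨c, hc, hcC⟩ := exists_pos_le_of_finite C hC
  obtain ⟨ε, hε, hε'⟩ := h.exists_eq_of_ht_lt
  -- the sequence of points obtained by rotating about the sides that separate from the polygon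
  let γ : ℕ → h.group := fun k => Nat.rec 1 (fun _ γ => ⟨h.gen (I γ), h.gen_mem_group _⟩ * γ) k
  let w : ℕ → ℍ := fun k => (γ k).1 • z
  let s : ℕ → ℝ := fun k => -ht (side V prev (I (γ k))) (w k)
  have hw : ∀ k, w (k + 1) = h.gen (I (γ k)) • w k := fun k => mul_smul _ _ _
  have hs : ∀ k, 0 < s k := fun k => neg_pos.mpr (hI (γ k))
  have hs' : ∀ k, ht (side V prev (I (γ k))) (w (k + 1)) = s k := fun k => by
    rw [hw, h.ht_side_gen_smul]
  have hne : ∀ k, I (γ k) ≠ I (γ (k + 1)) := by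
    intro k e
    have h1 := hs' k
    have h2 := hs (k + 1)
    have h3 := hs k
    simp only [s] at h2
    rw [← e] at h2
    linarith
  have hd : ∀ k, s k - s (k + 1) =
      ht (side V prev (I (γ k)) + side V prev (I (γ (k + 1)))) (w (k + 1)) := by
    intro k
    rw [ht_add, hs' k]
    simp only [s]; ring
  have hanti : Antitone s := antitone_nat_of_succ_le fun k => by
    have := hd k
    have := h.ht_side_add_pos (hne k) (w (k + 1))
    rw [← ht_add] at this
    linarith
  have hlim : Filter.Tendsto (fun k => s k - s (k + 1)) Filter.atTop (nhds 0) := by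
    have h1 := tendsto_atTop_ciInf hanti ⟨0, by rintro _ ⟨k, rfl⟩; exact (hs k).le⟩
    have h2 := h1.comp (Filter.tendsto_add_atTop_nat 1)
    simpa using h1.sub h2
  -- A decrement below c rules out non-adjacent sides; one below c ε forces the point into the
  -- ε-horodisc of the common vertex.
  obtain ⟨K, hK⟩ := Filter.eventually_atTop.mp
    (hlim.eventually (gt_mem_nhds (lt_min hc (mul_pos hc hε))))
  have hvertex : ∀ k, K ≤ k → ∃ l, (l = I (γ (k + 1)) ∨ l = prev (I (γ (k + 1)))) ∧
      c * ht (V l) (w (k + 1)) ≤ s k - s (k + 1) ∧ ht (V l) (w (k + 1)) < ε := by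
    intro k hk
    have h1 := hK k hk
    rw [lt_min_iff] at h1
    have hcc := hcC (I (γ k), I (γ (k + 1)))
    rcases hC' (I (γ k), I (γ (k + 1))) (hne k) with h2 | ⟨l, hl, h2⟩
    · have := h2 (w (k + 1))
      rw [← hd] at this
      linarith [h1.1]
    · have h3 := h2 (w (k + 1))
      rw [← hd] at h3
      have h4 : c * ht (V l) (w (k + 1)) ≤ s k - s (k + 1) :=
        (mul_le_mul_of_nonneg_right hcc (ht_pos (h.light l) _).le).trans h3
      exact ⟨l, hl, h4, lt_of_mul_lt_mul_left (h4.trans_lt h1.2) hc.le⟩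
  have hexists : ∃ η : ℝ, 0 < η ∧ ∀ k, K ≤ k →
      ∃ l, (l = I (γ (k + 1)) ∨ l = prev (I (γ (k + 1)))) ∧ ht (V l) (w (k + 1)) = η ∧
        c * η ≤ s k - s (k + 1) ∧ η < ε := by
    obtain ⟨l, hl, hl1, hl2⟩ := hvertex K le_rfl
    refine ⟨ht (V l) (w (K + 1)), ht_pos (h.light l) _, fun k hk => ?_⟩
    induction k, hk using Nat.le_induction with
    | base => exact ⟨l, hl, rfl, hl1, hl2⟩
    | succ k hk ih =>
      obtain ⟨m, hm, hm1, hm2, hm3⟩ := ih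
      obtain ⟨l', hl', hl1', hl2'⟩ := hvertex (k + 1) (by omega)
      obtain ⟨m', hm'⟩ := h.exists_vertex_gen_smul hm
      have h1 := hm' (w (k + 1))
      rw [← hw (k + 1), hm1] at h1
      -- The rotated vertex has the old height η < ε, so it is the vertex found at the next stage,
      -- because ε-horodiscs are disjoint.
      obtain rfl : m' = l' := hε' (w (k + 1 + 1)) m' l' (by rw [h1]; exact hm3) hl2'
      rw [h1] at hl1'
      exact ⟨m', hl', h1, hl1', hm3⟩
  obtain ⟨η, hη, hη'⟩ := hexists
  obtain ⟨K', hK'⟩ := Filter.eventually_atTop.mp (hlim.eventually (gt_mem_nhds (mul_pos hc hη)))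
  obtain ⟨-, -, -, h1, -⟩ := hη' (max K K') (le_max_left _ _)
  exact absurd (hK' _ (le_max_right K K')) h1.not_gt

/-! ### The translates of a point stay away from the cusps -/

/-- The rotated vertex lies beyond side `j`. In its `light_expansion` over the ends of the side, the
normal contributes a nonnegative term on the polygon's side, and the two ends give the bound. -/
theorem exists_le_ht_rot_vertex (h : IsIdealPolygon V prev f) {j k : ι} (hkj : k ≠ j)
    (hkj' : k ≠ prev j) : ∃ c : ℝ, 0 < c ∧
      ∀ z, 0 ≤ ht (side V prev j) z → c ≤ ht (rot (f j) (V k)) z := by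
  set a := V (prev j) with ha
  set b := V j with hb
  set u := rot (f j) (V k) with hu
  have hF : form a b < 0 := h.form_neg _ _ (h.prev_ne j)
  have hub : form u b < 0 := by
    rw [hb, ← h.rot_prev j, hu, form_rot_rot (time_form_ne (h.time j))]
    exact h.form_neg _ _ hkj'
  have hua : form u a < 0 := by
    rw [ha, ← h.rot_vertex j, hu, form_rot_rot (time_form_ne (h.time j))]
    exact h.form_neg _ _ hkj
  have hdet : det3 a b u < 0 := by
    have h1 := h.det_pos k j hkj hkj'
    rw [← det3_rot (time_form_ne (h.time j)), h.rot_prev, h.rot_vertex] at h1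
    have h2 : det3 (V j) (V (prev j)) u = -det3 a b u := by
      rw [ha, hb]; simp only [det3]; ring
    linarith
  obtain ⟨c, hc, hc'⟩ := exists_le_ht_add_ht (h.light (prev j)) (h.light j) hF
    (mul_pos_of_neg_of_neg hF hub) (mul_pos_of_neg_of_neg hF hua)
  have hF' : (0 : ℝ) < (form a b : ℝ) ^ 2 := by
    have : (form a b : ℝ) ≠ 0 := by exact_mod_cast hF.ne
    positivity
  refine ⟨c / (form a b : ℝ) ^ 2, div_pos hc hF', fun z hz => ?_⟩
  rw [div_le_iff₀ hF']
  have e := congrArg (fun v => ht v z) (light_expansion (h.light (prev j)).1 (h.light j).1 u)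
  simp only [ht_add, ht_smul] at e
  have hs : ht (cross (V (prev j)) (V j)) z = form a b * ht (side V prev j) z := by
    rw [side, ht_smul, ← mul_assoc]
    have : (form a b : ℝ) ≠ 0 := by exact_mod_cast hF.ne
    push_cast
    rw [mul_inv_cancel₀ this, one_mul]
  rw [hs] at e
  have h1 : (0 : ℝ) ≤ det3 a b u * (form a b * ht (side V prev j) z) := by
    rw [← mul_assoc]
    refine mul_nonneg ?_ hz
    exact_mod_cast (mul_pos_of_neg_of_neg hdet hF).le
  have h2 := hc' z
  push_cast at e h2
  linarith

/-- Induction on reduced words. A letter `j` exchanges the heights at the ends of side `j`; at any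
other vertex `exists_le_ht_rot_vertex` applies, since reducedness keeps the point before the
rotation on the polygon's side of side `j`. -/
theorem exists_le_ht_vertex_smul [Finite ι] (h : IsIdealPolygon V prev f) {z : ℍ}
    (hz : z ∈ closedPolygon V prev) :
    ∃ m : ℝ, 0 < m ∧ ∀ γ ∈ h.group, ∀ k, m ≤ ht (V k) (γ • z) := by
  classical
  have hgap : ∀ p : ι × ι, ∃ c : ℝ, 0 < c ∧ (p.2 ≠ p.1 → p.2 ≠ prev p.1 →
      ∀ z, 0 ≤ ht (side V prev p.1) z → c ≤ ht (rot (f p.1) (V p.2)) z) := by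
    rintro ⟨j, k⟩
    by_cases hkj : k ≠ j ∧ k ≠ prev j
    · obtain ⟨c, hc, hc'⟩ := h.exists_le_ht_rot_vertex hkj.1 hkj.2
      exact ⟨c, hc, fun _ _ => hc'⟩
    · exact ⟨1, one_pos, fun e e' => (hkj ⟨e, e'⟩).elim⟩
  choose C hC hC' using hgap
  obtain ⟨c, hc, hcC⟩ := exists_pos_le_of_finite C hC
  obtain ⟨d, hd, hd'⟩ := exists_pos_le_of_finite (fun k => ht (V k) z) fun k => ht_pos (h.light k) z
  refine ⟨min c d, lt_min hc hd, fun γ hγ => ?_⟩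
  obtain ⟨o, ho⟩ := exists_isReducedWord h.gen_mul_self hγ
  have key : (∀ i, o = some i → ht (side V prev i) (γ • z) ≤ 0) ∧
      ∀ k, min c d ≤ ht (V k) (γ • z) := by
    clear hγ
    induction ho with
    | one => exact ⟨by simp, fun k => by rw [one_smul]; exact (min_le_right _ _).trans (hd' k)⟩
    | @cons o γ j hγ ho ih =>
      have hj : 0 ≤ ht (side V prev j) (γ • z) := by
        cases o with
        | none => cases hγ; rw [one_smul]; exact hz j
        | some i =>
          have := ih.1 i rfl
          have := h.ht_side_add_pos (i := i) (j := j) (by simpa using ho) (γ • z)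
          linarith
      refine ⟨?_, fun k => ?_⟩
      · intro i hi
        obtain rfl : j = i := by simpa using hi
        rw [mul_smul, h.ht_side_gen_smul]
        linarith
      · rw [mul_smul, h.ht_gen_smul]
        by_cases h1 : k = j
        · rw [h1, h.rot_vertex]; exact ih.2 _
        · by_cases h2 : k = prev j
          · rw [h2, h.rot_prev]; exact ih.2 _
          · exact (min_le_left _ _).trans ((hcC (j, k)).trans (hC' (j, k) h1 h2 _ hj))
  exact key.2

end IsIdealPolygon

/-! ### Areas -/

theorem volume_eq_zero_of_image {s : Set ℍ} {N : Set ℂ} (hN : volume N = 0)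
    (h : ∀ z ∈ s, (z : ℂ) ∈ N) : volume s = 0 := by
  rw [UpperHalfPlane.volume_eq_lintegral]
  apply setLIntegral_measure_zero
  exact measure_mono_null (by rintro _ ⟨z, hz, rfl⟩; exact h z hz) hN

theorem volume_re_eq (c : ℝ) : volume {z : ℂ | z.re = c} = 0 := by
  have h := Complex.volume_preserving_equiv_real_prod.measure_preimage_equiv ({c} ×ˢ Set.univ)
  have e : Complex.measurableEquivRealProd ⁻¹' ({c} ×ˢ Set.univ) = {z : ℂ | z.re = c} := by
    ext z; simp [Complex.measurableEquivRealProd]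
  rw [e] at h
  rw [h, Measure.volume_eq_prod, Measure.prod_prod]
  simp

/-- Geodesic lines have area zero. -/
theorem volume_ht_eq_zero {m : Mink} (hm : 0 < form m m) :
    volume {z : ℍ | ht m z = 0} = 0 := by
  have hm' : (0 : ℝ) < (m 1 : ℝ) ^ 2 - ((m 0 : ℝ) - m 2) * ((m 0 : ℝ) + m 2) := by
    have : (0 : ℝ) < (form m m : ℝ) := by exact_mod_cast hm
    simp only [form] at this
    push_cast at this
    linarith
  have key : ∀ z : ℍ, ht m z = 0 →
      ((m 0 : ℝ) - m 2) * (z.re ^ 2 + z.im ^ 2) - 2 * m 1 * z.re + ((m 0 : ℝ) + m 2) = 0 := by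
    intro z hz
    rw [ht, div_eq_zero_iff] at hz
    exact hz.resolve_right z.im_pos.ne'
  by_cases hα : (m 0 : ℝ) - m 2 = 0
  · have hβ : (m 1 : ℝ) ≠ 0 := by
      intro h0; rw [hα, h0] at hm'; simp at hm'
    refine volume_eq_zero_of_image (volume_re_eq (((m 0 : ℝ) + m 2) / (2 * m 1))) fun z hz => ?_
    have := key z hz
    rw [hα, zero_mul] at this
    simp only [Set.mem_ofPred_eq, UpperHalfPlane.coe_re]
    rw [eq_div_iff (by simpa using hβ)]
    linarith
  · set α := (m 0 : ℝ) - m 2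
    set R := ((m 1 : ℝ) ^ 2 - α * ((m 0 : ℝ) + m 2)) / α ^ 2
    refine volume_eq_zero_of_image
      (Measure.addHaar_sphere volume ((m 1 / α : ℝ) : ℂ) (√R)) fun z hz => ?_
    have := key z hz
    rw [mem_sphere_iff_norm, Complex.norm_eq_sqrt_sq_add_sq]
    congr 1
    simp only [Complex.sub_re, Complex.sub_im, Complex.ofReal_re, Complex.ofReal_im,
      UpperHalfPlane.coe_re, UpperHalfPlane.coe_im, sub_zero, R]
    field_simp
    linear_combination α * this

/-- A vertical strip has finite area above any positive height. -/
theorem volume_strip_lt_top (s t : ℝ) {ε : ℝ} (hε : 0 < ε) :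
    volume {z : ℍ | s ≤ z.re ∧ z.re ≤ t ∧ ε < z.im} < ⊤ := by
  rw [UpperHalfPlane.volume_eq_lintegral]
  have h1 : IntegrableOn (fun p : ℝ × ℝ => (1 : ℝ) * p.2 ^ (-2 : ℝ))
      (Set.Icc s t ×ˢ Set.Ioi ε) := by
    rw [IntegrableOn, Measure.volume_eq_prod, ← Measure.prod_restrict]
    exact Integrable.mul_prod (f := fun _ : ℝ => (1 : ℝ)) (g := fun y : ℝ => y ^ (-2 : ℝ))
      (integrable_const _) (integrableOn_Ioi_rpow_of_lt (by norm_num) hε)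
  have h2 := h1.2
  rw [HasFiniteIntegral] at h2
  have h3 := Complex.volume_preserving_equiv_real_prod.setLIntegral_comp_preimage_emb
    Complex.measurableEquivRealProd.measurableEmbedding
    (fun p : ℝ × ℝ => ‖(1 : ℝ) * p.2 ^ (-2 : ℝ)‖ₑ) (Set.Icc s t ×ˢ Set.Ioi ε)
  rw [← h3] at h2
  refine lt_of_le_of_lt ?_ h2
  have hS : UpperHalfPlane.coe '' {z : ℍ | s ≤ z.re ∧ z.re ≤ t ∧ ε < z.im} ⊆
      Complex.measurableEquivRealProd ⁻¹' (Set.Icc s t ×ˢ Set.Ioi ε) := by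
    rintro _ ⟨z, hz, rfl⟩
    simpa [Complex.measurableEquivRealProd, and_assoc] using hz
  refine (lintegral_mono_set hS).trans (le_of_eq ?_)
  refine setLIntegral_congr_fun (Complex.measurableEquivRealProd.measurable
    (measurableSet_Icc.prod measurableSet_Ioi)) fun z hz => ?_
  have hz' : 0 < z.im := by
    have : z.re ∈ Set.Icc s t ∧ ε < z.im := by
      simpa [Complex.measurableEquivRealProd] using hz
    exact hε.trans this.2
  have hc : (Complex.measurableEquivRealProd z).2 = z.im := by
    simp [Complex.measurableEquivRealProd]
  rw [hc, one_mul]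
  rw [← ofReal_norm, Real.norm_of_nonneg (by positivity)]
  rw [ENNReal.ofReal, ENNReal.coe_inj]
  apply NNReal.eq
  rw [Real.coe_toNNReal _ (by positivity), Real.rpow_neg hz'.le, Real.rpow_two]
  simp

/-- The part of the region between the lines from `p` to `a` and to `b` which is in a horodisc
at `p`. -/
def cuspStrip (p a b : Mink) (c : ℝ) : Set ℍ :=
  {z | ht (cross p a) z ≤ 0 ∧ ht (cross b p) z ≤ 0 ∧ ht p z ≤ c}

theorem volume_cuspStrip_infty {p a b : Mink} (hp : p ∈ LightPlus) (h02 : p 0 = p 2)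
    (ha : form p a < 0) (hb : form p b < 0) {c : ℝ} (hc : 0 < c) :
    volume (cuspStrip p a b c) < ⊤ := by
  have hp0 : (0 : ℝ) < p 0 := by exact_mod_cast hp.2
  have hp1 : p 1 = 0 := by
    have := hp.1
    simp only [form, h02] at this
    exact mul_self_eq_zero.mp (by linarith)
  have key : ∀ a : Mink, form p a < 0 → (0 : ℝ) < (a 0 : ℝ) - a 2 := by
    intro a ha
    simp only [form, hp1, ← h02] at ha
    have : 0 < a 0 - a 2 := by
      have := hp.2
      by_contra hcon
      push Not at hcon
      nlinarith
    exact_mod_cast this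
  have ha' := key a ha
  have hb' := key b hb
  have h02' : (p 0 : ℝ) = p 2 := by exact_mod_cast h02
  have hp1' : (p 1 : ℝ) = 0 := by exact_mod_cast hp1
  -- For p at ∞ the horodisc is Im z ≥ 2 p₀/c, so the height p₀/c leaves room for the strict
  -- inequality.
  refine lt_of_le_of_lt (measure_mono ?_) (volume_strip_lt_top
    ((a 1 : ℝ) / ((a 0 : ℝ) - a 2)) ((b 1 : ℝ) / ((b 0 : ℝ) - b 2)) (div_pos hp0 hc))
  rintro z ⟨h1, h2, h3⟩
  have hy := z.im_pos
  simp only [ht, cross_zero', cross_one', cross_two', Rat.cast_neg, Rat.cast_sub, Rat.cast_mul,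
    h02', hp1', div_le_iff₀ hy, zero_mul] at h1 h2 h3
  rw [h02'] at hp0
  refine ⟨?_, ?_, ?_⟩
  · rw [div_le_iff₀ ha']
    nlinarith
  · rw [le_div_iff₀ hb']
    nlinarith
  · rw [div_lt_iff₀ hc, h02']
    nlinarith

/-- The rational half-turn about `p + q` preserves area and moves `p` to the vector `q` at ∞, where
the region lies in a vertical strip. -/
theorem volume_cuspStrip_lt_top {p a b : Mink} (hp : p ∈ LightPlus)
    (ha : form p a < 0) (hb : form p b < 0) {c : ℝ} (hc : 0 < c) :
    volume (cuspStrip p a b c) < ⊤ := by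
  by_cases h02 : p 0 = p 2
  · exact volume_cuspStrip_infty hp h02 ha hb hc
  set q : Mink := ![1, 0, 1] with hqd
  have hq : q ∈ LightPlus := by
    constructor <;> simp [hqd, form]
  have hpq : form p q < 0 := by
    refine lt_of_le_of_ne (light_form_nonpos hp hq) fun h => h02 ?_
    simp [hqd, form] at h
    linarith
  have hf : p + q ∈ TimePlus := by simpa using time_of_line hp hq hpq one_pos one_pos
  have hr : rot (p + q) p = q := by
    simpa using rot_line_left (s := 1) (t := 1) hp.1 hq.1 hpq.ne one_ne_zero one_ne_zero
  have hfn := time_form_ne hf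
  have e : cuspStrip q (rot (p + q) a) (rot (p + q) b) c =
      (fun z => rotPGL (p + q) hf • z) ⁻¹' cuspStrip p a b c := by
    ext z
    simp only [cuspStrip, Set.mem_preimage, Set.mem_ofPred_eq, ht_rotPGL_smul]
    rw [← cross_rot hfn, ← cross_rot hfn, hr]
  have hqa : form q (rot (p + q) a) < 0 := by
    have := form_rot_rot hfn p a
    rw [hr] at this
    rwa [this]
  have hqb : form q (rot (p + q) b) < 0 := by
    have := form_rot_rot hfn p b
    rw [hr] at this
    rwa [this]
  have h := volume_cuspStrip_infty (a := rot (p + q) a) (b := rot (p + q) b) hq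
    (by simp [hqd]) hqa
    hqb hc
  rwa [e, measure_preimage_smul] at h

/-- The ideal triangle with the vertices `p`, `a`, `b`. -/
def idealTriangle (p a b : Mink) : Set ℍ :=
  {z | ht (cross p a) z ≤ 0 ∧ ht (cross a b) z ≤ 0 ∧ ht (cross b p) z ≤ 0}

/-- Let Z be the time-like vector of `z`, with ⟨Z, Z⟩ = -4. The three heights are, up to the factor
-1/det, the coordinates of Z in the basis `p`, `a`, `b`; the identity compares Lorentz norms. -/
theorem ht_cross_quadratic {p a b : Mink} (hp : form p p = 0) (ha : form a a = 0)
    (hb : form b b = 0) (z : ℍ) :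
    ht (cross a b) z * ht (cross b p) z * form p a + ht (cross b p) z * ht (cross p a) z * form a b
      + ht (cross p a) z * ht (cross a b) z * form b p = -2 * (det3 p a b : ℝ) ^ 2 := by
  have hZ : ∀ v : Mink, ht v z = v 0 * ((z.re ^ 2 + z.im ^ 2 + 1) / z.im) -
      v 1 * (2 * z.re / z.im) - v 2 * ((z.re ^ 2 + z.im ^ 2 - 1) / z.im) := by
    intro v; rw [ht]; ring
  have hQ : (2 * z.re / z.im) ^ 2 + ((z.re ^ 2 + z.im ^ 2 - 1) / z.im) ^ 2 -
      ((z.re ^ 2 + z.im ^ 2 + 1) / z.im) ^ 2 = -4 := by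
    have := z.im_pos.ne'
    field_simp; ring
  have hp' : (p 1 : ℝ) * p 1 + p 2 * p 2 - p 0 * p 0 = 0 := by exact_mod_cast hp
  have ha' : (a 1 : ℝ) * a 1 + a 2 * a 2 - a 0 * a 0 = 0 := by exact_mod_cast ha
  have hb' : (b 1 : ℝ) * b 1 + b 2 * b 2 - b 0 * b 0 = 0 := by exact_mod_cast hb
  rw [hZ, hZ, hZ]
  generalize (z.re ^ 2 + z.im ^ 2 + 1) / z.im = Z0 at *
  generalize 2 * z.re / z.im = Z1 at *
  generalize (z.re ^ 2 + z.im ^ 2 - 1) / z.im = Z2 at *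
  simp only [cross_zero', cross_one', cross_two', form, det3]
  push_cast
  set α := -((a 1 : ℝ) * b 2 - a 2 * b 1) * Z0 - (a 2 * b 0 - a 0 * b 2) * Z1 -
    (a 0 * b 1 - a 1 * b 0) * Z2 with hα
  set β := -((b 1 : ℝ) * p 2 - b 2 * p 1) * Z0 - (b 2 * p 0 - b 0 * p 2) * Z1 -
    (b 0 * p 1 - b 1 * p 0) * Z2 with hβ
  set γ := -((p 1 : ℝ) * a 2 - p 2 * a 1) * Z0 - (p 2 * a 0 - p 0 * a 2) * Z1 -
    (p 0 * a 1 - p 1 * a 0) * Z2 with hγ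
  set D := (p 0 : ℝ) * (a 1 * b 2 - a 2 * b 1) - p 1 * (a 0 * b 2 - a 2 * b 0) +
    p 2 * (a 0 * b 1 - a 1 * b 0) with hD
  have e0 : α * p 0 + β * a 0 + γ * b 0 = -(D * Z0) := by simp only [hα, hβ, hγ, hD]; ring
  have e1 : α * p 1 + β * a 1 + γ * b 1 = -(D * Z1) := by simp only [hα, hβ, hγ, hD]; ring
  have e2 : α * p 2 + β * a 2 + γ * b 2 = -(D * Z2) := by simp only [hα, hβ, hγ, hD]; ring
  clear_value α β γ D
  linear_combination (1 / 2) * (α * p 1 + β * a 1 + γ * b 1 - D * Z1) * e1 +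
    (1 / 2) * (α * p 2 + β * a 2 + γ * b 2 - D * Z2) * e2 -
    (1 / 2) * (α * p 0 + β * a 0 + γ * b 0 - D * Z0) * e0 - α ^ 2 / 2 * hp' - β ^ 2 / 2 * ha' -
    γ ^ 2 / 2 * hb' + D ^ 2 / 2 * hQ

/-- Ideal triangles have finite area. -/
theorem volume_idealTriangle_lt_top {p a b : Mink} (hp : p ∈ LightPlus) (ha : a ∈ LightPlus)
    (hb : b ∈ LightPlus) (hpos : 0 < det3 p a b) : volume (idealTriangle p a b) < ⊤ := by
  have hpa : form p a < 0 := form_neg_of_det3_ne_zero hp ha hb hpos.ne'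
  have hab : form a b < 0 := by
    rw [← det3_rotate] at hpos; exact form_neg_of_det3_ne_zero ha hb hp hpos.ne'
  have hbp : form b p < 0 := by
    rw [← det3_rotate, ← det3_rotate] at hpos; exact form_neg_of_det3_ne_zero hb hp ha hpos.ne'
  have hpa' : (form p a : ℝ) < 0 := by exact_mod_cast hpa
  have hab' : (form a b : ℝ) < 0 := by exact_mod_cast hab
  have hbp' : (form b p : ℝ) < 0 := by exact_mod_cast hbp
  have hD : (0 : ℝ) < det3 p a b := by exact_mod_cast hpos
  -- an upper bound for the second smallest barycentric coordinate
  obtain ⟨m, hm, hmm⟩ := exists_pos_le_of_finite (![-(form p a : ℝ), -form a b, -form b p]) (by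
    intro i; fin_cases i <;> simp [hpa, hab, hbp])
  have hm1 : m ≤ -form p a := hmm 0
  have hm2 : m ≤ -form a b := hmm 1
  have hm3 : m ≤ -form b p := hmm 2
  set K := √(2 * (det3 p a b : ℝ) ^ 2 / m) with hK
  have hK0 : 0 < K := Real.sqrt_pos.mpr (by positivity)
  have hKK : K * K * m = 2 * (det3 p a b : ℝ) ^ 2 := by
    rw [hK, Real.mul_self_sqrt (by positivity)]; field_simp
  set c := K * (-form p a - form a b - form b p) / det3 p a b with hc
  have hc0 : 0 < c := by
    apply div_pos (mul_pos hK0 (by linarith)) hD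
  -- Two coordinates cannot both exceed K, or their term alone would exceed the right side of
  -- `ht_cross_quadratic`. The two that are at most K bound the height at the remaining vertex by c.
  have hsub : idealTriangle p a b ⊆ cuspStrip p a b c ∪ cuspStrip a b p c ∪ cuspStrip b p a c := by
    rintro z ⟨h1, h2, h3⟩
    have hq := ht_cross_quadratic hp.1 ha.1 hb.1 z
    have ep := congrArg (fun v => ht v z) (cross_add_cross a p b)
    have eb := congrArg (fun v => ht v z) (cross_add_cross p b a)
    have ea := congrArg (fun v => ht v z) (cross_add_cross b a p)
    simp only [ht_add, ht_smul, hp.1, ha.1, hb.1] at ep eb ea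
    rw [cross_swap p a, cross_swap b p, ht_neg, ht_neg, form_comm p b, form_comm a p] at ep
    rw [cross_swap b p, cross_swap a b, ht_neg, ht_neg, form_comm b a, form_comm p b] at eb
    rw [cross_swap a b, cross_swap p a, ht_neg, ht_neg, form_comm a p, form_comm b a] at ea
    have d1 : det3 a p b = -det3 p a b := by simp only [det3]; ring
    have d2 : det3 p b a = -det3 p a b := by simp only [det3]; ring
    have d3 : det3 b a p = -det3 p a b := by simp only [det3]; ring
    rw [d1] at ep
    rw [d2] at eb
    rw [d3] at ea
    push_cast at ep eb ea
    set α := -ht (cross a b) z with hα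
    set β := -ht (cross b p) z with hβ
    set γ := -ht (cross p a) z with hγ
    have hα0 : 0 ≤ α := by linarith
    have hβ0 : 0 ≤ β := by linarith
    have hγ0 : 0 ≤ γ := by linarith
    have hsum : α * β * (-form p a) + β * γ * (-form a b) + γ * α * (-form b p) =
        2 * (det3 p a b : ℝ) ^ 2 := by
      simp only [hα, hβ, hγ]; linarith
    have hpair : ∀ x y w : ℝ, m ≤ w → K < x → K < y → K * K * m < x * y * w := by
      intro x y w hw hx hy
      exact mul_lt_mul (mul_lt_mul'' hx hy hK0.le hK0.le) hw hm
        (mul_pos (hK0.trans hx) (hK0.trans hy)).le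
    have t1 : 0 ≤ α * β * (-form p a) := mul_nonneg (by positivity) (by linarith)
    have t2 : 0 ≤ β * γ * (-form a b) := mul_nonneg (by positivity) (by linarith)
    have t3 : 0 ≤ γ * α * (-form b p) := mul_nonneg (by positivity) (by linarith)
    by_cases hβK : β ≤ K
    · by_cases hγK : γ ≤ K
      · refine .inl (.inl ⟨h1, h3, ?_⟩)
        rw [hc, le_div_iff₀ hD]
        nlinarith [mul_le_mul_of_nonneg_right hβK (neg_nonneg.mpr hpa'.le),
          mul_le_mul_of_nonneg_right hγK (neg_nonneg.mpr hbp'.le)]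
      · have hαK : α ≤ K := by
          by_contra h
          linarith [hpair γ α _ hm3 (not_le.mp hγK) (not_le.mp h)]
        refine .inr ⟨h3, h2, ?_⟩
        rw [hc, le_div_iff₀ hD]
        nlinarith [mul_le_mul_of_nonneg_right hβK (neg_nonneg.mpr hab'.le),
          mul_le_mul_of_nonneg_right hαK (neg_nonneg.mpr hbp'.le)]
    · have hαK : α ≤ K := by
        by_contra h
        linarith [hpair α β _ hm1 (not_le.mp h) (not_le.mp hβK)]
      have hγK : γ ≤ K := by
        by_contra h
        linarith [hpair β γ _ hm2 (not_le.mp hβK) (not_le.mp h)]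
      refine .inl (.inr ⟨h2, h1, ?_⟩)
      rw [hc, le_div_iff₀ hD]
      nlinarith [mul_le_mul_of_nonneg_right hαK (neg_nonneg.mpr hpa'.le),
        mul_le_mul_of_nonneg_right hγK (neg_nonneg.mpr hab'.le)]
  refine lt_of_le_of_lt (measure_mono hsub) (measure_union_lt_top (measure_union_lt_top ?_ ?_) ?_)
  · exact volume_cuspStrip_lt_top hp hpa (by rwa [form_comm]) hc0
  · exact volume_cuspStrip_lt_top ha hab (by rwa [form_comm]) hc0
  · exact volume_cuspStrip_lt_top hb hbp (by rwa [form_comm]) hc0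

theorem IsIdealPolygon.form_side_side {ι : Type*} {V : ι → Mink} {prev : ι → ι} {f : ι → Mink}
    (h : IsIdealPolygon V prev f) (i : ι) : form (side V prev i) (side V prev i) = 1 := by
  have e : ∀ a b : Mink, form (cross a b) (cross a b) = form a b ^ 2 - form a a * form b b := by
    intro a b
    simp only [form, cross_zero', cross_one', cross_two']; ring
  have hne := (h.form_neg _ _ (h.prev_ne i)).ne
  rw [side, form_smul_left, form_smul_right, e, (h.light i).1]
  field_simp
  ring

namespace IsPolygonConstruction

variable {n : ℕ} {v₀ vinf : Mink} {y x v f : ℕ → Mink}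

/-- The polygon of the construction has finite area. -/
theorem volume_lt_top (h : IsPolygonConstruction n v₀ vinf y x v f) (hn : 2 ≤ n)
    (hv₀ : v₀ ∈ LightPlus) (hvinf : vinf ∈ LightPlus)
    (hy : ∀ i, 1 ≤ i → i < n → y i ∈ LightPlus) :
    volume (IsIdealPolygon.closedPolygon (fun i : Fin (n + 1) => v i) (fun i => i - 1)) < ⊤ := by
  have hv := h.v_light hv₀
  have hP := h.isIdealPolygon hn hv₀ hvinf hy
  have hsub : IsIdealPolygon.closedPolygon (fun i : Fin (n + 1) => v i) (fun i => i - 1) ⊆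
      ⋃ i ∈ Finset.range (n - 1), idealTriangle (v n) (v i) (v (i + 1)) := by
    intro z hz
    have hs : ∀ i : Fin (n + 1), ht (cross (v (i - 1 : Fin (n + 1))) (v i)) z ≤ 0 := by
      intro i
      have h1 := hz i
      have h2 : form (v (i - 1 : Fin (n + 1))) (v i) < 0 := hP.form_neg _ _ (hP.prev_ne i)
      have h3 : (form (v (i - 1 : Fin (n + 1))) (v i) : ℝ) < 0 := by exact_mod_cast h2
      rw [side, ht_smul] at h1
      push_cast at h1
      exact nonpos_of_mul_nonneg_right h1 (inv_lt_zero.mpr h3)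
    have hlast : ht (cross (v n) (v 0)) z ≤ 0 := by
      have := hs 0
      rw [Fin.coe_sub_one] at this
      simpa using this
    have hside : ∀ i, i < n → ht (cross (v i) (v (i + 1))) z ≤ 0 := by
      intro i hi
      have := hs ⟨i + 1, by omega⟩
      rw [Fin.coe_sub_one, if_neg (by rw [Fin.ext_iff]; simp)] at this
      simpa using this
    have hpen : 0 ≤ ht (cross (v n) (v (n - 1))) z := by
      have := hside (n - 1) (by omega)
      rw [Nat.sub_add_cancel (by omega), cross_swap, ht_neg] at this
      linarith
    -- The polygon is cut into a fan of triangles at v_n; a sign change along the diagonals from v_n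
    -- finds the triangle that contains z.
    have key : ∀ k, k ≤ n - 1 → 0 ≤ ht (cross (v n) (v k)) z → 1 ≤ k →
        ∃ i, i < n - 1 ∧ ht (cross (v n) (v i)) z ≤ 0 ∧ 0 ≤ ht (cross (v n) (v (i + 1))) z := by
      intro k hk h0 hk1
      induction k, hk1 using Nat.le_induction with
      | base => exact ⟨0, by omega, hlast, h0⟩
      | succ k hk1 ih =>
        rcases le_total (ht (cross (v n) (v k)) z) 0 with h1 | h1
        · exact ⟨k, by omega, h1, h0⟩
        · exact ih (by omega) h1
    obtain ⟨i, hi, h1, h2⟩ := key (n - 1) le_rfl hpen (by omega)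
    simp only [Set.mem_iUnion]
    refine ⟨i, Finset.mem_range.mpr hi, h1, hside i (by omega), ?_⟩
    rw [cross_swap, ht_neg]
    linarith
  refine lt_of_le_of_lt (measure_mono hsub) ?_
  refine (measure_biUnion_finset_le _ _).trans_lt (ENNReal.sum_lt_top.mpr fun i hi => ?_)
  have hi' := Finset.mem_range.mp hi
  refine volume_idealTriangle_lt_top (hv n le_rfl) (hv i (by omega)) (hv (i + 1) (by omega)) ?_
  rw [← det3_rotate]
  exact h.det3_pos hn hv₀ hvinf hy _ _ _ (by omega) (by omega) le_rfl

end IsPolygonConstruction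

/-! ### The actions of `PSL(2, ℚ)` and `PSL(2, ℝ)` -/

theorem pslReal_mk_smul (g : SL(2, ℝ)) (z : ℍ) : (QuotientGroup.mk g : PSL(2, ℝ)) • z = g • z :=
  rfl

theorem ratToReal_smul (δ : PSL(2, ℚ)) (z : ℍ) :
    ratToReal δ • z = Matrix.ProjectiveSpecialLinearGroup.toPGL δ • z := by
  induction δ using QuotientGroup.induction_on with | H g =>
  change Matrix.ProjGenLinGroup.mk (Matrix.SpecialLinearGroup.toGL
      (Matrix.SpecialLinearGroup.map (n := Fin 2) (algebraMap ℚ ℝ) g)) • z =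
    Matrix.ProjGenLinGroup.mk (Matrix.GeneralLinearGroup.map (algebraMap ℚ ℝ)
      (Matrix.SpecialLinearGroup.toGL g)) • z
  congr 2
  ext i j
  rfl

instance : ContinuousConstSMul PSL(2, ℝ) ℍ := by
  refine ⟨fun x => ?_⟩
  induction x using QuotientGroup.induction_on with | H g =>
  simp only [pslReal_mk_smul]
  exact continuous_const_smul g

theorem continuous_pslReal_smul (z : ℍ) : Continuous fun x : PSL(2, ℝ) => x • z := by
  refine isQuotientMap_quotient_mk'.continuous_iff.mpr ?_
  change Continuous fun g : SL(2, ℝ) => g • z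
  fun_prop

instance : Countable PGL(2, ℚ) :=
  have : Countable (Matrix (Fin 2) (Fin 2) ℚ) := inferInstanceAs (Countable (Fin 2 → Fin 2 → ℚ))
  have : Countable (GL (Fin 2) ℚ) := Function.Injective.countable (f := fun g => g.val)
    Units.val_injective
  Matrix.ProjGenLinGroup.mk_surjective.countable

/-! ### Discreteness, covolume and cusps -/

namespace IsIdealPolygon

variable {ι : Type*} {V : ι → Mink} {prev : ι → ι} {f : ι → Mink}

theorem isOpen_openPolygon [Finite ι] (V : ι → Mink) (prev : ι → ι) :
    IsOpen (openPolygon V prev) := by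
  have : openPolygon V prev = ⋂ i, {z | 0 < ht (side V prev i) z} := by
    ext z; simp [openPolygon]
  rw [this]
  exact isOpen_iInter_of_finite fun i => isOpen_lt continuous_const (continuous_ht _)

/-- The group is countable, so the translates of all sides together have area zero. -/
theorem ae_exists_smul_mem_openPolygon [Finite ι] (h : IsIdealPolygon V prev f) :
    ∀ᵐ z : ℍ, ∃ γ ∈ h.group, γ • z ∈ openPolygon V prev := by
  have h1 : ∀ᵐ z : ℍ, ∀ γ : PGL(2, ℚ), ∀ i, ht (side V prev i) (γ • z) ≠ 0 := by
    have : Countable ι := Finite.to_countable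
    rw [ae_all_iff]
    intro γ
    rw [ae_all_iff]
    intro i
    have h2 := volume_ht_eq_zero (m := side V prev i) (by rw [h.form_side_side]; exact one_pos)
    rw [← measure_preimage_smul (μ := volume) γ] at h2
    rw [ae_iff]
    simpa using h2
  filter_upwards [h1] with z hz
  obtain ⟨γ, hγ, h2⟩ := h.exists_smul_mem_closedPolygon z
  exact ⟨γ, hγ, fun i => lt_of_le_of_ne (h2 i) (hz γ i).symm⟩

theorem openPolygon_nonempty [Finite ι] (h : IsIdealPolygon V prev f) :
    (openPolygon V prev).Nonempty := by
  have : (volume : Measure ℍ) ≠ 0 := by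
    intro h0
    have h1 : (volume : Measure ℍ) Set.univ = 0 := by rw [h0]; simp
    rw [UpperHalfPlane.volume_eq_lintegral] at h1
    refine h1.not_gt ((setLIntegral_pos_iff (by fun_prop)).mpr ?_)
    refine (IsOpen.measure_pos volume (U := {w : ℂ | 0 < w.im})
      (isOpen_lt continuous_const Complex.continuous_im) ⟨Complex.I, by simp⟩).trans_le
      (measure_mono fun w hw => ⟨?_, ⟨⟨w, hw⟩, trivial, rfl⟩⟩)
    have : w.im ≠ 0 := ne_of_gt hw
    simpa using this
  have : (ae (volume : Measure ℍ)).NeBot := ae_neBot.mpr this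
  obtain ⟨z, γ, -, hz⟩ := h.ae_exists_smul_mem_openPolygon.exists
  exact ⟨_, hz⟩

/-- For `z` in the open polygon, the elements moving `z` into the polygon form an open set that
meets the group only in 1. -/
theorem isFuchsian [Finite ι] (h : IsIdealPolygon V prev f) {Δ : Subgroup PSL(2, ℚ)}
    (hΔ : Δ ≤ kernelPSL h.group) : IsFuchsian (Δ.map ratToReal) := by
  obtain ⟨z, hz⟩ := h.openPolygon_nonempty
  rw [IsFuchsian]
  refine discreteTopology_of_isOpen_singleton_one ?_
  have ho : IsOpen {x : PSL(2, ℝ) | x • z ∈ openPolygon V prev} :=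
    (isOpen_openPolygon V prev).preimage (continuous_pslReal_smul z)
  have : ({1} : Set (Δ.map ratToReal)) =
      Subtype.val ⁻¹' {x : PSL(2, ℝ) | x • z ∈ openPolygon V prev} := by
    ext ⟨x, δ, hδ, rfl⟩
    simp only [Set.mem_singleton_iff, Set.mem_preimage, Set.mem_ofPred_eq, Subtype.ext_iff,
      Subgroup.coe_one]
    constructor
    · intro e; rw [e, one_smul]; exact hz
    · intro e
      rw [ratToReal_smul] at e
      have := h.eq_one_of_smul_mem (hΔ hδ) hz e
      rw [Matrix.ProjectiveSpecialLinearGroup.toPGL_injective (this.trans (map_one _).symm),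
        map_one]
  rw [this]
  exact ho.preimage continuous_subtype_val

/-- The domain is the union of r⁻¹P over representatives r of the finitely many left cosets of Δ in
Γ, with P the open polygon: if γz ∈ P and γ = rδ, then δz ∈ r⁻¹P. -/
theorem hasFiniteCovolume [Finite ι] (h : IsIdealPolygon V prev f)
    (hvol : volume (closedPolygon V prev) < ⊤) {Δ : Subgroup PSL(2, ℚ)}
    (hΔ : Δ ≤ kernelPSL h.group)
    (hfin : (Δ.map Matrix.ProjectiveSpecialLinearGroup.toPGL).IsFiniteRelIndex h.group) :
    HasFiniteCovolume (Δ.map ratToReal) := by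
  set H := Δ.map Matrix.ProjectiveSpecialLinearGroup.toPGL with hH
  have hHG : H ≤ h.group := by
    rintro _ ⟨δ, hδ, rfl⟩
    exact hΔ hδ
  have hfin' : Finite (h.group ⧸ H.subgroupOf h.group) := by
    have := hfin.relIndex_ne_zero
    rw [Subgroup.relIndex] at this
    have : (H.subgroupOf h.group).FiniteIndex := ⟨this⟩
    exact Subgroup.finite_quotient_of_finiteIndex
  let r : h.group ⧸ H.subgroupOf h.group → PGL(2, ℚ) := fun q => (Quotient.out q).1
  have hr : ∀ q, r q ∈ h.group := fun q => (Quotient.out q).2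
  have hmeas : MeasurableSet (⋃ q, (fun z => r q • z) ⁻¹' openPolygon V prev) :=
    MeasurableSet.iUnion fun q =>
      (measurable_const_smul (r q)) (isOpen_openPolygon V prev).measurableSet
  refine ⟨⋃ q, (fun z => r q • z) ⁻¹' openPolygon V prev, ⟨hmeas.nullMeasurableSet, ?_, ?_⟩, ?_⟩
  · filter_upwards [h.ae_exists_smul_mem_openPolygon] with z hz
    obtain ⟨γ, hγ, hz⟩ := hz
    set q : h.group ⧸ H.subgroupOf h.group := QuotientGroup.mk ⟨γ, hγ⟩
    have hq : (Quotient.out q)⁻¹ * ⟨γ, hγ⟩ ∈ H.subgroupOf h.group :=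
      QuotientGroup.eq.mp (Quotient.out_eq q)
    obtain ⟨δ, hδ, e⟩ := Subgroup.mem_subgroupOf.mp hq
    refine ⟨⟨ratToReal δ, δ, hδ, rfl⟩, Set.mem_iUnion.mpr ⟨q, ?_⟩⟩
    change r q • (ratToReal δ • z) ∈ openPolygon V prev
    rw [ratToReal_smul, e, ← mul_smul]
    change (r q * ((r q)⁻¹ * γ)) • z ∈ _
    rwa [mul_inv_cancel_left]
  · rintro ⟨_, δ₁, hδ₁, rfl⟩ ⟨_, δ₂, hδ₂, rfl⟩ hne
    refine Disjoint.aedisjoint (Set.disjoint_left.mpr fun z h1 h2 => hne ?_)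
    rw [Set.mem_smul_set_iff_inv_smul_mem, Set.mem_iUnion] at h1 h2
    obtain ⟨q₁, h1⟩ := h1
    obtain ⟨q₂, h2⟩ := h2
    change r q₁ • ((ratToReal δ₁)⁻¹ • z) ∈ openPolygon V prev at h1
    change r q₂ • ((ratToReal δ₂)⁻¹ • z) ∈ openPolygon V prev at h2
    rw [← map_inv, ratToReal_smul, map_inv, ← mul_smul] at h1 h2
    set t₁ := Matrix.ProjectiveSpecialLinearGroup.toPGL δ₁ with ht₁
    set t₂ := Matrix.ProjectiveSpecialLinearGroup.toPGL δ₂ with ht₂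
    have m1 : t₁ ∈ H := ⟨δ₁, hδ₁, rfl⟩
    have m2 : t₂ ∈ H := ⟨δ₂, hδ₂, rfl⟩
    have e : (r q₂ * t₂⁻¹) * (r q₁ * t₁⁻¹)⁻¹ = 1 := by
      refine h.eq_one_of_smul_mem ?_ h1 ?_
      · exact mul_mem (mul_mem (hr _) (inv_mem (hHG m2)))
          (inv_mem (mul_mem (hr _) (inv_mem (hHG m1))))
      · rwa [← mul_smul, inv_mul_cancel_right]
    rw [mul_inv_eq_one] at e
    have hq : q₁ = q₂ := by
      rw [← Quotient.out_eq q₁, ← Quotient.out_eq q₂]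
      refine QuotientGroup.eq.mpr (Subgroup.mem_subgroupOf.mpr ?_)
      change (r q₁)⁻¹ * r q₂ ∈ H
      have : (r q₁)⁻¹ * r q₂ = t₁⁻¹ * t₂ := by
        rw [eq_mul_of_mul_inv_eq e]
        group
      rw [this]
      exact mul_mem (inv_mem m1) m2
    subst hq
    have e' : t₂ = t₁ := inv_injective (mul_left_cancel e)
    have := Matrix.ProjectiveSpecialLinearGroup.toPGL_injective e'
    subst this
    rfl
  · refine (measure_iUnion_le _).trans_lt ?_
    simp only [measure_preimage_smul]
    have hvol' : volume (openPolygon V prev) < ⊤ :=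
      (measure_mono fun z hz i => (hz i).le).trans_lt hvol
    have := Fintype.ofFinite (h.group ⧸ H.subgroupOf h.group)
    rw [tsum_fintype]
    exact ENNReal.sum_lt_top.mpr fun _ _ => hvol'

theorem exists_light_ht_smul (h : IsIdealPolygon V prev f) {γ : PGL(2, ℚ)} (hγ : γ ∈ h.group) :
    ∀ v ∈ LightPlus, ∃ u ∈ LightPlus, ∀ z, ht v (γ • z) = ht u z := by
  obtain ⟨o, ho⟩ := exists_isReducedWord h.gen_mul_self hγ
  clear hγ
  induction ho with
  | one => exact fun v hv => ⟨v, hv, fun z => by rw [one_smul]⟩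
  | @cons o γ i _ _ ih =>
    intro v hv
    obtain ⟨u, hu, e⟩ := ih _ (light_rot hv (h.time i))
    exact ⟨u, hu, fun z => by rw [mul_smul, h.ht_gen_smul, e]⟩

theorem exists_ht_lt {v : Mink} (hv : v ∈ LightPlus) {ε : ℝ} (hε : 0 < ε) :
    ∃ z : ℍ, ht v z < ε := by
  obtain ⟨a, c, h1, h2, h3, h4⟩ := exists_light_param hv
  by_cases ha : a = 0
  · subst ha
    refine ⟨⟨⟨0, (c ^ 2 + 1) / ε⟩, by positivity⟩, ?_⟩
    rw [ht_of_param h1 h2 h3]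
    change ((0 * _ - c) ^ 2 + (0 * _) ^ 2) / ((c ^ 2 + 1) / ε) < ε
    rw [div_lt_iff₀ (by positivity), mul_div_cancel₀ _ hε.ne']
    simp
  · refine ⟨⟨⟨c / a, ε / (2 * a ^ 2)⟩, by positivity⟩, ?_⟩
    rw [ht_of_param h1 h2 h3]
    change ((a * (c / a) - c) ^ 2 + (a * (ε / (2 * a ^ 2))) ^ 2) / (ε / (2 * a ^ 2)) < ε
    rw [mul_div_cancel₀ _ ha, div_lt_iff₀ (by positivity)]
    have : (a * (ε / (2 * a ^ 2))) ^ 2 = ε * (ε / (2 * a ^ 2)) / 2 := by field_simp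
    have : 0 < ε * (ε / (2 * a ^ 2)) := by positivity
    rw [sub_self]
    linarith

/-- `W k` consists of the points whose whole Γ-orbit has height at least 2⁻ᵏ at one cusp. The
interiors of these sets exhaust the plane, so a compact quotient would be covered by a single one,
yet heights come arbitrarily close to 0. -/
theorem not_isCocompact [Finite ι] (h : IsIdealPolygon V prev f) (i₀ : ι)
    {Δ : Subgroup PSL(2, ℚ)} (hΔ : Δ ≤ kernelPSL h.group) :
    ¬ IsCocompact (Δ.map ratToReal) := by
  intro hcpt
  have : ContinuousConstSMul (Δ.map ratToReal) ℍ :=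
    ⟨fun x => continuous_const_smul (x : PSL(2, ℝ))⟩
  rw [IsCocompact] at hcpt
  let W : ℕ → Set ℍ := fun k => {z | ∀ γ ∈ h.group, (1 / 2 : ℝ) ^ k ≤ ht (V i₀) (γ • z)}
  have hWmono : Monotone W := by
    intro k l hkl z hz γ hγ
    exact (pow_le_pow_of_le_one (by norm_num) (by norm_num) hkl).trans (hz γ hγ)
  have hWint : ∀ k, W k ⊆ interior (W (k + 1)) := by
    intro k w hw
    rw [mem_interior_iff_mem_nhds]
    filter_upwards [eventually_half_ht_le w] with z hz γ hγ
    obtain ⟨u, hu, e⟩ := h.exists_light_ht_smul hγ (V i₀) (h.light i₀)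
    have h1 := hw γ hγ
    rw [e] at h1 ⊢
    have := hz u hu
    rw [pow_succ]
    linarith
  have hWcover : ∀ z, ∃ k, z ∈ W k := by
    intro z
    obtain ⟨γ₀, hγ₀, h0⟩ := h.exists_smul_mem_closedPolygon z
    obtain ⟨m, hm, hm'⟩ := h.exists_le_ht_vertex_smul h0
    obtain ⟨k, hk⟩ := exists_pow_lt_of_lt_one hm (show (1 / 2 : ℝ) < 1 by norm_num)
    refine ⟨k, fun γ hγ => hk.le.trans ?_⟩
    have := hm' (γ * γ₀⁻¹) (mul_mem hγ (inv_mem hγ₀)) i₀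
    rwa [← mul_smul, inv_mul_cancel_right] at this
  have hopen : ∀ k, IsOpen ((Quotient.mk (MulAction.orbitRel (Δ.map ratToReal) ℍ)) ''
      (interior (W k))) := fun k =>
    isOpenMap_quotient_mk'_mul _ isOpen_interior
  obtain ⟨k, hk⟩ := (isCompact_univ (X := MulAction.orbitRel.Quotient (Δ.map ratToReal) ℍ)
    ).elim_directed_cover _ hopen (by
      rintro ⟨z⟩ -
      obtain ⟨k, hk⟩ := hWcover z
      exact Set.mem_iUnion.mpr ⟨k + 1, z, hWint k hk, rfl⟩)
    (Monotone.directed_le fun k l hkl => Set.image_mono (interior_mono (hWmono hkl)))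
  obtain ⟨z, hz⟩ := exists_ht_lt (h.light i₀) (show (0 : ℝ) < (1 / 2) ^ k by positivity)
  obtain ⟨w, hw, e⟩ := hk (Set.mem_univ (Quotient.mk _ z))
  obtain ⟨⟨_, δ, hδ, rfl⟩, e'⟩ := Quotient.exact e
  have hw' := interior_subset hw
  change ratToReal δ • z = w at e'
  rw [ratToReal_smul] at e'
  have := hw' _ (inv_mem (hΔ hδ))
  rw [← e', inv_smul_smul] at this
  linarith

end IsIdealPolygon

/-! ### The index of `Γ ∩ PSL(2, ℚ)` in `Γ` -/

/-- The determinant as a class modulo squares. -/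
def detClass : PGL(2, ℚ) →* ℚˣ ⧸ (powMonoidHom 2 : ℚˣ →* ℚˣ).range :=
  Matrix.ProjGenLinGroup.lift ((QuotientGroup.mk' _).comp Matrix.GeneralLinearGroup.det) (by
    ext u
    refine (QuotientGroup.eq_one_iff _).mpr ⟨u, ?_⟩
    ext
    simp)

theorem toPGL_mk_eq {h : SL(2, ℚ)} {g : GL (Fin 2) ℚ} {r : ℚ} (hr : r ≠ 0)
    (e : g.val = r • h.val) :
    Matrix.ProjectiveSpecialLinearGroup.toPGL (QuotientGroup.mk h : PSL(2, ℚ)) =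
      Matrix.ProjGenLinGroup.mk g := by
  rw [Matrix.ProjectiveSpecialLinearGroup.toPGL_mk, Matrix.ProjGenLinGroup.mk_eq_mk_iff]
  refine ⟨Units.mk0 r hr, ?_⟩
  ext i j
  have := congrFun (congrFun e i) j
  simp [this, Matrix.scalar_apply, Matrix.mul_diagonal, mul_comm]

theorem mem_range_toPGL_of_detClass {g : PGL(2, ℚ)} (hg : detClass g = 1) :
    g ∈ (Matrix.ProjectiveSpecialLinearGroup.toPGL (n := Fin 2) (R := ℚ)).range := by
  induction g using Matrix.ProjGenLinGroup.induction_on with | mk g =>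
  rw [detClass, Matrix.ProjGenLinGroup.lift_mk] at hg
  obtain ⟨r, hr⟩ := (QuotientGroup.eq_one_iff _).mp hg
  have hr' : (r : ℚ) ^ 2 = g.val.det := by
    have := congrArg Units.val hr
    simpa using this
  have hr0 : (r : ℚ) ≠ 0 := r.ne_zero
  have hdet : ((r : ℚ)⁻¹ • g.val).det = 1 := by
    rw [Matrix.det_smul, ← hr', Fintype.card_fin, ← mul_pow, inv_mul_cancel₀ hr0, one_pow]
  let h : SL(2, ℚ) := ⟨_, hdet⟩
  exact ⟨QuotientGroup.mk h, toPGL_mk_eq hr0 (smul_inv_smul₀ hr0 g.val).symm⟩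

/-- The determinant maps the finitely generated group to an abelian group of exponent 2, so the
image is finite; a class of square determinant can be rescaled into `SL(2, ℚ)`. -/
theorem isFiniteRelIndex_kernelPSL {S : Set PGL(2, ℚ)} (hS : S.Finite) :
    ((kernelPSL (Subgroup.closure S)).map
      Matrix.ProjectiveSpecialLinearGroup.toPGL).IsFiniteRelIndex (Subgroup.closure S) := by
  set Γ := Subgroup.closure S
  have := hS.to_subtype
  have hfg : Group.FG Γ := Group.closure_finite_fg S
  let φ := detClass.comp Γ.subtype
  have hfin : Finite φ.range := by
    refine CommGroup.finite_of_fg_isMulTorsion _ ?_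
    rintro ⟨x, -⟩
    refine isOfFinOrder_iff_pow_eq_one.mpr ⟨2, by norm_num, Subtype.ext ?_⟩
    induction x using QuotientGroup.induction_on with | H u =>
    exact (QuotientGroup.eq_one_iff _).mpr ⟨u, rfl⟩
  have hker : φ.ker.FiniteIndex := by
    have : Finite (Γ ⧸ φ.ker) := Finite.of_equiv _ (QuotientGroup.quotientKerEquivRange φ).symm.toEquiv
    exact Subgroup.finiteIndex_of_finite_quotient
  have hle : φ.ker ≤ ((kernelPSL Γ).map
      Matrix.ProjectiveSpecialLinearGroup.toPGL).subgroupOf Γ := by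
    rintro ⟨g, hg⟩ h1
    obtain ⟨δ, hδ⟩ := mem_range_toPGL_of_detClass (g := g) h1
    refine Subgroup.mem_subgroupOf.mpr ⟨δ, ?_, hδ⟩
    change _ ∈ Γ
    rwa [hδ]
  have := Subgroup.finiteIndex_of_le hle
  exact ⟨this.index_ne_zero⟩

/-! ### Hyperbolic elements with given fixed points -/

/-- The entries of `symMatrix v` are given by the square of the linear form with coefficients
`a` and `-c`, the zero of which is `c / a`. -/
structure IsParam (v : Mink) (a c : ℝ) : Prop where
  eq_sub : (v 0 : ℝ) - v 2 = a ^ 2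
  eq_one : (v 1 : ℝ) = a * c
  eq_add : (v 0 : ℝ) + v 2 = c ^ 2

theorem IsParam.form_eq {u v : Mink} {a c a' c' : ℝ} (hu : IsParam u a c) (hv : IsParam v a' c') :
    (form u v : ℝ) = -(c * a' - c' * a) ^ 2 / 2 := by
  obtain ⟨h1, h2, h3⟩ := hu
  obtain ⟨h1', h2', h3'⟩ := hv
  have e1 : (u 0 : ℝ) = (a ^ 2 + c ^ 2) / 2 := by linarith
  have e2 : (u 2 : ℝ) = (c ^ 2 - a ^ 2) / 2 := by linarith
  have e3 : (v 0 : ℝ) = (a' ^ 2 + c' ^ 2) / 2 := by linarith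
  have e4 : (v 2 : ℝ) = (c' ^ 2 - a' ^ 2) / 2 := by linarith
  simp only [form]; push_cast
  rw [e1, e2, e3, e4, h2, h2']; ring

theorem IsParam.ne_zero_of_form_neg {u v : Mink} {a c a' c' : ℝ} (hu : IsParam u a c)
    (hv : IsParam v a' c') (h : form u v < 0) : c * a' - c' * a ≠ 0 := by
  intro h0
  have h1 := hu.form_eq hv
  rw [h0] at h1
  have h2 : (form u v : ℝ) < 0 := by exact_mod_cast h
  rw [h1] at h2
  simp at h2

theorem exists_isParam {v : Mink} (hv : v ∈ LightPlus) :
    ∃ a c, IsParam v a c ∧ (a ≠ 0 ∨ c ≠ 0) := by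
  obtain ⟨a, c, h1, h2, h3, h4⟩ := exists_light_param hv
  exact ⟨a, c, ⟨h1, h2, h3⟩, h4⟩

theorem bdry_eq_of_isParam {v : Mink} {a c : ℝ} (h : IsParam v a c) :
    bdry v = if a = 0 then OnePoint.infty else ((c / a : ℝ) : OnePoint ℝ) := by
  have h1 : form v (e 2 + e 0) = v 2 - v 0 := by simp [form, e]
  have h2 : form v (e 1) = v 1 := by simp [form, e]
  have h3 : ((v 2 - v 0 : ℚ) : ℝ) = -a ^ 2 := by push_cast; linarith [h.eq_sub]
  have h4 : v 2 - v 0 = 0 ↔ a = 0 := by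
    rw [← Rat.cast_eq_zero (α := ℝ), h3]; simp
  rw [bdry, h1, h2]
  split_ifs with h5 h6 h6
  · rfl
  · exact (h6 (h4.mp h5)).elim
  · exact (h5 (h4.mpr h6)).elim
  · congr 1
    rw [Rat.cast_div, h3, Rat.cast_neg, h.eq_one]
    field_simp

/-- The matrix with the columns `(c, a)` and `(c', a')`. -/
def colMatrix (a c a' c' : ℝ) : Matrix (Fin 2) (Fin 2) ℝ := !![c, c'; a, a']

/-- In the basis of its two ends a half-turn about a point of the line is antidiagonal, so a product
of two such half-turns is diagonal. -/
theorem rotMatrix_mul_colMatrix {x y : Mink} {a c a' c' : ℝ} (hx : IsParam x a c)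
    (hy : IsParam y a' c') (s t : ℚ) :
    (rotMatrix (s • x + t • y)).map (algebraMap ℚ ℝ) * colMatrix a c a' c' =
      colMatrix a c a' c' * !![0, s * (c * a' - c' * a); -(t * (c * a' - c' * a)), 0] := by
  have e : (rotMatrix (s • x + t • y)).map (algebraMap ℚ ℝ) =
      !![-(s * (a * c) + t * (a' * c')), s * c ^ 2 + t * c' ^ 2;
        -(s * a ^ 2 + t * a' ^ 2), s * (a * c) + t * (a' * c')] := by
    rw [← hx.eq_sub, ← hx.eq_one, ← hx.eq_add, ← hy.eq_sub, ← hy.eq_one, ← hy.eq_add]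
    ext i j
    fin_cases i <;> fin_cases j <;> simp [rotMatrix, symMatrix, form, RatFuchsian.e] <;> ring
  rw [e, colMatrix, Matrix.mul_fin_two, Matrix.mul_fin_two]
  ext i j
  fin_cases i <;> fin_cases j <;> simp <;> ring

/-- If `f` and `g` are distinct points of the line from `x` to `y`, then the square of `ρ_g ρ_f`
is a hyperbolic element of `PSL(2, ℚ)` with the axis from `x` to `y`. -/
theorem exists_hyperbolic {x y f g : Mink} (hx : x ∈ LightPlus) (hy : y ∈ LightPlus)
    (hxy : form x y < 0) (hf : f ∈ TimePlus) (hg : g ∈ TimePlus) (hfl : f ∈ line x y)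
    (hgl : g ∈ line x y) (hfg : ∀ c : ℚ, c ≠ 0 → g ≠ c • f) {Γ : Subgroup PGL(2, ℚ)}
    (hfΓ : rotPGL f hf ∈ Γ) (hgΓ : rotPGL g hg ∈ Γ) :
    ∃ h : SL(2, ℚ), (QuotientGroup.mk h : PSL(2, ℚ)) ∈ kernelPSL Γ ∧
      ∃ μ : ℝ, 0 < μ ∧ μ ≠ 1 ∧ ∀ a c a' c', IsParam x a c → IsParam y a' c' →
        (Matrix.SpecialLinearGroup.map (algebraMap ℚ ℝ) h).val * colMatrix a c a' c' =
          colMatrix a c a' c' * !![μ, 0; 0, μ⁻¹] := by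
  set δ := form f f * form g g with hδ
  have hδ0 : δ ≠ 0 := mul_ne_zero (time_form_ne hf) (time_form_ne hg)
  -- The product of the two rotations has determinant δ, which need not be a square in ℚ; its square
  -- has determinant δ² and can be divided by δ.
  have hdet : (δ⁻¹ • ((rotMatrix g * rotMatrix f) * (rotMatrix g * rotMatrix f))).det = 1 := by
    rw [Matrix.det_smul, Matrix.det_mul, Matrix.det_mul, rotMatrix_det, rotMatrix_det,
      Fintype.card_fin, hδ]
    have := time_form_ne hf
    have := time_form_ne hg
    field_simp
  let h : SL(2, ℚ) := ⟨_, hdet⟩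
  refine ⟨h, ?_, ?_⟩
  · have e : Matrix.ProjectiveSpecialLinearGroup.toPGL (QuotientGroup.mk h : PSL(2, ℚ)) =
        (rotPGL g hg * rotPGL f hf) * (rotPGL g hg * rotPGL f hf) := by
      rw [rotPGL, rotPGL, ← map_mul, ← map_mul]
      exact toPGL_mk_eq hδ0 (smul_inv_smul₀ hδ0 _).symm
    change _ ∈ Γ
    rw [e]
    exact mul_mem (mul_mem hgΓ hfΓ) (mul_mem hgΓ hfΓ)
  · obtain ⟨s, t, hs, ht, rfl⟩ := hfl
    obtain ⟨s', t', hs', ht', rfl⟩ := hgl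
    have hne : s * t' ≠ s' * t := by
      intro e
      refine hfg (s' / s) (by positivity) ?_
      rw [smul_add, smul_smul, smul_smul, div_mul_cancel₀ _ hs.ne']
      congr 2
      field_simp
      linarith
    have hs0 : (0 : ℝ) < s := by exact_mod_cast hs
    have ht0 : (0 : ℝ) < t := by exact_mod_cast ht
    have hs0' : (0 : ℝ) < s' := by exact_mod_cast hs'
    have ht0' : (0 : ℝ) < t' := by exact_mod_cast ht'
    -- The product is diagonal with entries -s'tκ² and -st'κ²; squaring and dividing by δ = sts't'κ⁴
    -- leaves this ratio and its inverse. It is not 1 because the centres are different points.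
    refine ⟨(s' * t) / (s * t'), by positivity, ?_, ?_⟩
    · rw [Ne, div_eq_one_iff_eq (by positivity)]
      exact fun h => hne (by exact_mod_cast h.symm)
    · intro a c a' c' h1 h2
      set κ := c * a' - c' * a with hκ
      have hform := h1.form_eq h2
      have hκ0 : κ ≠ 0 := h1.ne_zero_of_form_neg h2 hxy
      have hff : ∀ s t : ℚ, (form (s • x + t • y) (s • x + t • y) : ℝ) = -(s * t * κ ^ 2) := by
        intro s t
        simp only [form_add_left, form_add_right, form_smul_left, form_smul_right, hx.1, hy.1,
          form_comm y x]
        push_cast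
        rw [hform]; ring
      have hδ' : (δ : ℝ) = s * t * s' * t' * κ ^ 4 := by
        rw [hδ, Rat.cast_mul, hff, hff]; ring
      have ef := rotMatrix_mul_colMatrix h1 h2 s t
      have eg := rotMatrix_mul_colMatrix h1 h2 s' t'
      rw [← hκ] at ef eg
      set Q := colMatrix a c a' c'
      set F := (rotMatrix (s • x + t • y)).map (algebraMap ℚ ℝ)
      set G := (rotMatrix (s' • x + t' • y)).map (algebraMap ℚ ℝ)
      have egf : G * F * (G * F) * Q = Q * !![(s' * t * κ ^ 2) ^ 2, 0; 0, (s * t' * κ ^ 2) ^ 2] := by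
        rw [Matrix.mul_assoc (G * F), Matrix.mul_assoc G F Q, ef, ← Matrix.mul_assoc G, eg,
          Matrix.mul_assoc Q, ← Matrix.mul_assoc (G * F), Matrix.mul_assoc G F Q, ef,
          ← Matrix.mul_assoc G, eg, Matrix.mul_assoc, Matrix.mul_assoc]
        congr 1
        simp only [Matrix.mul_fin_two]
        ext i j
        fin_cases i <;> fin_cases j <;> simp <;> ring
      have hval : (Matrix.SpecialLinearGroup.map (algebraMap ℚ ℝ) h).val =
          (δ : ℝ)⁻¹ • (G * F * (G * F)) := by
        simp only [F, G, ← Matrix.map_mul]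
        ext i j
        change algebraMap ℚ ℝ (δ⁻¹ * _) = (δ : ℝ)⁻¹ * algebraMap ℚ ℝ _
        rw [map_mul, map_inv₀, eq_ratCast]
      rw [hval, Matrix.smul_mul, egf, ← Matrix.mul_smul, hδ']
      congr 1
      ext i j
      fin_cases i <;> fin_cases j <;> simp <;> field_simp

theorem det_colMatrix (a c a' c' : ℝ) : (colMatrix a c a' c').det = c * a' - c' * a := by
  rw [colMatrix, Matrix.det_fin_two_of]

/-- A hyperbolic element with the axis from `x` to `y` fixes `y`. -/
theorem bdry_mem_HFix {y : Mink} {G : Subgroup PSL(2, ℝ)} {h : SL(2, ℝ)}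
    (hh : (QuotientGroup.mk h : PSL(2, ℝ)) ∈ G) {μ : ℝ} (hμ : 0 < μ) (hμ1 : μ ≠ 1)
    {a c a' c' : ℝ} (hy : IsParam y a' c') (hdet : c * a' - c' * a ≠ 0)
    (he : h.val * colMatrix a c a' c' = colMatrix a c a' c' * !![μ, 0; 0, μ⁻¹]) :
    bdry y ∈ HFix G := by
  have hQ : (colMatrix a c a' c').det ≠ 0 := by rwa [det_colMatrix]
  refine ⟨h, hh, ?_, ?_⟩
  · let Q := Matrix.GeneralLinearGroup.mkOfDetNeZero _ hQ
    have e : h.val = Q.val * !![μ, 0; 0, μ⁻¹] * Q.val⁻¹ := by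
      change _ = colMatrix a c a' c' * !![μ, 0; 0, μ⁻¹] * (colMatrix a c a' c')⁻¹
      rw [← he, Matrix.mul_nonsing_inv_cancel_right _ _ (isUnit_iff_ne_zero.mpr hQ)]
    rw [e, Matrix.isHyperbolic_conj_iff, Matrix.IsHyperbolic, Matrix.discr_fin_two,
      Matrix.trace_fin_two_of, Matrix.det_fin_two_of]
    have h1 : (μ + μ⁻¹) ^ 2 - 4 * (μ * μ⁻¹ - 0 * 0) = (μ - μ⁻¹) ^ 2 := by
      field_simp; ring
    rw [h1]
    have : μ - μ⁻¹ ≠ 0 := by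
      intro h0
      field_simp at h0
      have : (μ - 1) * (μ + 1) = 0 := by linarith
      rcases mul_eq_zero.mp this with h2 | h2
      · exact hμ1 (by linarith)
      · linarith
    positivity
  · have h0 : h.val 0 0 * c' + h.val 0 1 * a' = c' * μ⁻¹ := by
      have := congrFun (congrFun he 0) 1
      simpa [colMatrix, Matrix.mul_apply, Fin.sum_univ_two] using this
    have h1 : h.val 1 0 * c' + h.val 1 1 * a' = a' * μ⁻¹ := by
      have := congrFun (congrFun he 1) 1
      simpa [colMatrix, Matrix.mul_apply, Fin.sum_univ_two] using this
    have hμi : μ⁻¹ ≠ 0 := inv_ne_zero hμ.ne'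
    rw [bdry_eq_of_isParam hy]
    split_ifs with ha
    · subst ha
      have hc : c' ≠ 0 := by rintro rfl; simp at hdet
      rw [OnePoint.smul_infty_eq_self_iff]
      have : h.val 1 0 * c' = 0 := by simpa using h1
      exact (mul_eq_zero.mp this).resolve_right hc
    · have e1 : h.val 1 0 * (c' / a') + h.val 1 1 = μ⁻¹ := by
        field_simp at h1 ⊢
        linarith
      have e0 : h.val 0 0 * (c' / a') + h.val 0 1 = (c' / a') * μ⁻¹ := by
        field_simp; field_simp at h0; linarith
      rw [OnePoint.smul_some_eq_ite]
      change (if h.val 1 0 * (c' / a') + h.val 1 1 = 0 then OnePoint.infty else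
        (((h.val 0 0 * (c' / a') + h.val 0 1) / (h.val 1 0 * (c' / a') + h.val 1 1) : ℝ) :
          OnePoint ℝ)) = _
      rw [e1, e0, if_neg hμi, mul_div_cancel_right₀ _ hμi]

/-! ### Axes of hyperbolic elements of a Fuchsian group -/

/-- In a Fuchsian group, an element with arbitrarily small conjugates is trivial. -/
theorem IsFuchsian.mem_center_of_tendsto {G : Subgroup PSL(2, ℝ)} (hG : IsFuchsian G)
    {g w : SL(2, ℝ)} (hg : (QuotientGroup.mk g : PSL(2, ℝ)) ∈ G)
    (hw : (QuotientGroup.mk w : PSL(2, ℝ)) ∈ G)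
    (ht : Filter.Tendsto (fun k : ℕ => g ^ k * w * (g ^ k)⁻¹) Filter.atTop (nhds 1)) :
    w ∈ Subgroup.center SL(2, ℝ) := by
  have hG' : DiscreteTopology G := hG
  obtain ⟨U, hU, hU1⟩ := isOpen_induced_iff.mp (isOpen_discrete ({1} : Set G))
  have h1 : (QuotientGroup.mk (1 : SL(2, ℝ)) : PSL(2, ℝ)) ∈ U := by
    have : (1 : G) ∈ Subtype.val ⁻¹' U := by rw [hU1]; rfl
    exact this
  have hc : Continuous (QuotientGroup.mk : SL(2, ℝ) → PSL(2, ℝ)) := continuous_quotient_mk'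
  obtain ⟨k, hk⟩ := (((hc.tendsto 1).comp ht).eventually (hU.mem_nhds h1)).exists
  have hm : (QuotientGroup.mk (g ^ k * w * (g ^ k)⁻¹) : PSL(2, ℝ)) ∈ G :=
    G.mul_mem (G.mul_mem (G.pow_mem hg k) hw) (G.inv_mem (G.pow_mem hg k))
  have h2 : (⟨_, hm⟩ : G) ∈ Subtype.val ⁻¹' U := hk
  rw [hU1] at h2
  have h3 : g ^ k * w * (g ^ k)⁻¹ ∈ Subgroup.center SL(2, ℝ) :=
    (QuotientGroup.eq_one_iff _).mp (congrArg Subtype.val (Set.mem_singleton_iff.mp h2))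
  have h4 := Subgroup.Normal.conj_mem inferInstance _ h3 (g ^ k)⁻¹
  simpa [mul_assoc] using h4

/-- Lower triangular matrices of determinant one. -/
def lowMatrix (a : ℝˣ) (t : ℝ) : GL (Fin 2) ℝ where
  val := !![a, 0; t, (a⁻¹ : ℝˣ)]
  inv := !![(a⁻¹ : ℝˣ), 0; -t, a]
  val_inv := by
    ext i j; fin_cases i <;> fin_cases j <;> simp [mul_comm]
  inv_val := by
    ext i j; fin_cases i <;> fin_cases j <;> simp [mul_comm]

theorem lowMatrix_mul (a b : ℝˣ) (s t : ℝ) :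
    lowMatrix a s * lowMatrix b t = lowMatrix (a * b) (s * b + (a⁻¹ : ℝˣ) * t) := by
  ext i j; fin_cases i <;> fin_cases j <;> simp [lowMatrix, mul_comm]

theorem lowMatrix_inv (a : ℝˣ) (t : ℝ) : (lowMatrix a t)⁻¹ = lowMatrix a⁻¹ (-t) := by
  rw [inv_eq_iff_mul_eq_one, lowMatrix_mul]
  ext i j; fin_cases i <;> fin_cases j <;> simp [lowMatrix, mul_comm]

theorem lowMatrix_conj (a : ℝˣ) (t : ℝ) :
    lowMatrix a 0 * lowMatrix 1 t * (lowMatrix a 0)⁻¹ = lowMatrix 1 (((a⁻¹ : ℝˣ) : ℝ) ^ 2 * t) := by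
  rw [lowMatrix_inv, lowMatrix_mul, lowMatrix_mul]
  congr 1
  · simp
  · simp; ring

theorem lowMatrix_commutator (a b : ℝˣ) (t : ℝ) :
    lowMatrix a 0 * lowMatrix b t * (lowMatrix a 0)⁻¹ * (lowMatrix b t)⁻¹ =
      lowMatrix 1 (((a⁻¹ : ℝˣ) ^ 2 - 1 : ℝ) * t * (b⁻¹ : ℝˣ)) := by
  rw [lowMatrix_inv, lowMatrix_inv, lowMatrix_mul, lowMatrix_mul, lowMatrix_mul]
  congr 1
  · simp
  · simp; ring

/-- The commutator of two elements with a common fixed point is unipotent, and conjugation by powers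
of g₁ shrinks its entry by a⁻² each time. Discreteness makes the commutator trivial, which forces `t
= 0`. -/
theorem IsFuchsian.eq_zero_of_conj {G : Subgroup PSL(2, ℝ)} (hG : IsFuchsian G)
    {g₁ g₂ : SL(2, ℝ)} (hg₁ : (QuotientGroup.mk g₁ : PSL(2, ℝ)) ∈ G)
    (hg₂ : (QuotientGroup.mk g₂ : PSL(2, ℝ)) ∈ G) {q : GL (Fin 2) ℝ} {a b : ℝˣ} {t : ℝ}
    (ha : 1 < (a : ℝ))
    (e₁ : Matrix.SpecialLinearGroup.toGL g₁ = MulAut.conj q (lowMatrix a 0))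
    (e₂ : Matrix.SpecialLinearGroup.toGL g₂ = MulAut.conj q (lowMatrix b t)) : t = 0 := by
  set r : ℝ := ((a⁻¹ : ℝˣ) : ℝ) ^ 2 with hr
  have ha0 : (0 : ℝ) < a := by linarith
  have hi1 : ((a⁻¹ : ℝˣ) : ℝ) < 1 := by
    rw [Units.val_inv_eq_inv_val]; exact inv_lt_one_of_one_lt₀ ha
  have hi0 : 0 < ((a⁻¹ : ℝˣ) : ℝ) := by
    rw [Units.val_inv_eq_inv_val]; exact inv_pos.mpr ha0
  have hr0 : 0 ≤ r := by positivity
  have hr1 : r < 1 := by rw [hr]; nlinarith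
  set u : ℝ := (r - 1) * t * ((b⁻¹ : ℝˣ) : ℝ) with hu
  set w : SL(2, ℝ) := g₁ * g₂ * g₁⁻¹ * g₂⁻¹ with hw
  have ew : Matrix.SpecialLinearGroup.toGL w = MulAut.conj q (lowMatrix 1 u) := by
    rw [hw, map_mul, map_mul, map_mul, map_inv, map_inv, e₁, e₂, ← map_inv, ← map_inv, ← map_mul,
      ← map_mul, ← map_mul, lowMatrix_commutator]
  have hwG : (QuotientGroup.mk w : PSL(2, ℝ)) ∈ G :=
    G.mul_mem (G.mul_mem (G.mul_mem hg₁ hg₂) (G.inv_mem hg₁)) (G.inv_mem hg₂)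
  have ek : ∀ k : ℕ, Matrix.SpecialLinearGroup.toGL (g₁ ^ k * w * (g₁ ^ k)⁻¹) =
      MulAut.conj q (lowMatrix 1 (r ^ k * u)) := by
    intro k
    induction k with
    | zero => simpa using ew
    | succ k ih =>
      have : g₁ ^ (k + 1) * w * (g₁ ^ (k + 1))⁻¹ = g₁ * (g₁ ^ k * w * (g₁ ^ k)⁻¹) * g₁⁻¹ := by
        rw [pow_succ']; group
      rw [this, map_mul, map_mul, map_inv, ih, e₁, ← map_inv, ← map_mul, ← map_mul, lowMatrix_conj,
        ← hr]
      congr 2; ring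
  have hlow : Matrix.of ![![(1 : ℝ), 0], ![0, 1]] = 1 := Matrix.one_fin_two.symm
  have htend : Filter.Tendsto (fun k : ℕ => g₁ ^ k * w * (g₁ ^ k)⁻¹) Filter.atTop (nhds 1) := by
    refine tendsto_subtype_rng.mpr ?_
    have hval : ∀ k : ℕ, (g₁ ^ k * w * (g₁ ^ k)⁻¹).val =
        q.val * !![1, 0; r ^ k * u, 1] * (q⁻¹).val := by
      intro k
      have e : (lowMatrix 1 (r ^ k * u)).val = !![1, 0; r ^ k * u, 1] := by simp [lowMatrix]
      rw [← e]
      exact congrArg Units.val (ek k)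
    have hcont : Continuous fun s : ℝ => q.val * !![1, 0; s, 1] * (q⁻¹).val := by
      have : Continuous fun s : ℝ => !![1, 0; s, 1] := by
        refine continuous_matrix fun i j => ?_
        fin_cases i <;> fin_cases j <;> simp <;> fun_prop
      fun_prop
    have hlim : Filter.Tendsto (fun k : ℕ => r ^ k * u) Filter.atTop (nhds 0) := by
      simpa using (tendsto_pow_atTop_nhds_zero_of_lt_one hr0 hr1).mul_const u
    have := (hcont.tendsto 0).comp hlim
    rw [hlow, mul_one, ← Units.val_mul, mul_inv_cancel] at this
    exact this.congr fun k => (hval k).symm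
  have hcen := hG.mem_center_of_tendsto hg₁ hwG htend
  obtain ⟨s, -, hs⟩ := Matrix.SpecialLinearGroup.mem_center_iff.mp hcen
  have hq : (lowMatrix 1 u).val = (q⁻¹).val * w.val * q.val := by
    have h1 : lowMatrix 1 u = q⁻¹ * Matrix.SpecialLinearGroup.toGL w * q := by
      rw [ew, MulAut.conj_apply]; group
    exact congrArg Units.val h1
  rw [← hs, Matrix.mul_assoc, (Matrix.scalar_commute s (Commute.all s) _).eq, ← Matrix.mul_assoc,
    ← Units.val_mul, inv_mul_cancel, Units.val_one, one_mul] at hq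
  have hu0 : u = 0 := by
    have := congrFun (congrFun hq 1) 0
    simpa [lowMatrix, Matrix.scalar_apply] using this
  have hb : ((b⁻¹ : ℝˣ) : ℝ) ≠ 0 := Units.ne_zero _
  have h3 : r - 1 ≠ 0 := by linarith
  rw [hu] at hu0
  exact (mul_eq_zero.mp ((mul_eq_zero.mp hu0).resolve_right hb)).resolve_left h3

/-- Two axes of a Fuchsian group with a common end have both ends in common. -/
theorem IsFuchsian.eq_of_common_end {G : Subgroup PSL(2, ℝ)} (hG : IsFuchsian G)
    {g₁ g₂ : SL(2, ℝ)} (hg₁ : (QuotientGroup.mk g₁ : PSL(2, ℝ)) ∈ G)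
    (hg₂ : (QuotientGroup.mk g₂ : PSL(2, ℝ)) ∈ G) {μ₁ μ₂ a₁ c₁ a₂ c₂ a c : ℝ}
    (hμ₁ : 0 < μ₁) (hμ₁' : μ₁ ≠ 1) (hμ₂ : 0 < μ₂) (hμ₂' : μ₂ ≠ 1)
    (h₁ : c₁ * a - c * a₁ ≠ 0) (h₂ : c₂ * a - c * a₂ ≠ 0)
    (e₁ : g₁.val * colMatrix a₁ c₁ a c = colMatrix a₁ c₁ a c * !![μ₁, 0; 0, μ₁⁻¹])
    (e₂ : g₂.val * colMatrix a₂ c₂ a c = colMatrix a₂ c₂ a c * !![μ₂, 0; 0, μ₂⁻¹]) :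
    c₁ * a₂ - c₂ * a₁ = 0 := by
  let q := Matrix.GeneralLinearGroup.mkOfDetNeZero (colMatrix a₁ c₁ a c)
    (by rwa [det_colMatrix])
  have toConj : ∀ {g : SL(2, ℝ)} {l : GL (Fin 2) ℝ},
      g.val * colMatrix a₁ c₁ a c = colMatrix a₁ c₁ a c * l.val →
      Matrix.SpecialLinearGroup.toGL g = MulAut.conj q l := by
    intro g l hgl
    rw [MulAut.conj_apply, eq_mul_inv_iff_mul_eq]
    exact Units.ext hgl
  set κ := c₂ * a - c * a₂
  set α := (c₁ * a - c * a₁) / κ with hα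
  set β := (c₂ * a₁ - c₁ * a₂) / κ with hβ
  let b := Units.mk0 μ₂ hμ₂.ne'
  -- The two eigenbases share the second column, so the change of basis is lower triangular. Its
  -- entry β vanishes exactly if the other ends agree.
  have hcol : colMatrix a₁ c₁ a c = colMatrix a₂ c₂ a c * !![α, 0; β, 1] := by
    have x1 : c₁ = c₂ * α + c * β := by
      rw [hα, hβ]; field_simp; simp only [κ]; ring
    have x2 : a₁ = a₂ * α + a * β := by
      rw [hα, hβ]; field_simp; simp only [κ]; ring
    ext i j
    fin_cases i <;> fin_cases j <;> simp [colMatrix, Matrix.mul_apply, Fin.sum_univ_two]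
    · exact x1
    · exact x2
  have e₂' : Matrix.SpecialLinearGroup.toGL g₂ =
      MulAut.conj q (lowMatrix b (β * (μ₂⁻¹ - μ₂))) := by
    refine toConj ?_
    rw [hcol, ← Matrix.mul_assoc, e₂, Matrix.mul_assoc, Matrix.mul_assoc]
    congr 1
    ext i j
    fin_cases i <;> fin_cases j <;> simp [lowMatrix, b, mul_comm]
    ring
  have e₁' : ∀ u : ℝˣ, (u : ℝ) = μ₁ →
      Matrix.SpecialLinearGroup.toGL g₁ = MulAut.conj q (lowMatrix u 0) := by
    intro u hu
    refine toConj ?_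
    rw [e₁, ← hu]
    congr 1
    ext i j
    fin_cases i <;> fin_cases j <;> simp [lowMatrix]
  -- The contraction needs an eigenvalue larger than 1; otherwise g₁ is replaced by its inverse.
  have hτ : β * (μ₂⁻¹ - μ₂) = 0 := by
    rcases lt_or_gt_of_ne hμ₁' with hlt | hgt
    · refine hG.eq_zero_of_conj (G.inv_mem hg₁) hg₂ (a := (Units.mk0 μ₁ hμ₁.ne')⁻¹) ?_ ?_ e₂'
      · rw [Units.val_inv_eq_inv_val]
        exact (one_lt_inv₀ hμ₁).mpr hlt
      · have := congrArg (·⁻¹) (e₁' (Units.mk0 μ₁ hμ₁.ne') rfl)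
        rw [← map_inv, ← map_inv, lowMatrix_inv, neg_zero] at this
        exact this
    · exact hG.eq_zero_of_conj hg₁ hg₂ (a := Units.mk0 μ₁ hμ₁.ne') hgt (e₁' _ rfl) e₂'
  have hne : μ₂⁻¹ - μ₂ ≠ 0 := by
    intro h0
    field_simp at h0
    have : (μ₂ - 1) * (μ₂ + 1) = 0 := by linarith
    rcases mul_eq_zero.mp this with h2 | h2
    · exact hμ₂' (by linarith)
    · linarith
  have hβ0 := (mul_eq_zero.mp hτ).resolve_right hne
  rw [hβ, div_eq_zero_iff] at hβ0
  have := hβ0.resolve_right h₂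
  linarith

/-! ### The groups of the polygon construction -/

/-- Different rational points of the line from `a` to `b` reflect a boundary point `p` to
different boundary points. -/
theorem det3_rot_rot_ne_zero {p a b : Mink} (hp : p ∈ LightPlus) (hab : det3 p a b ≠ 0) {s t : ℚ}
    (hst : s ≠ t) (hs : a + s • b ∈ TimePlus) (ht : a + t • b ∈ TimePlus) :
    det3 p (rot (a + s • b) p) (rot (a + t • b) p) ≠ 0 := by
  have key : ∀ α β : ℚ, det3 p (α • (a + s • b) - p) (β • (a + t • b) - p) =
      α * β * (t - s) * det3 p a b := by
    intro α β
    simp only [det3, Pi.add_apply, Pi.sub_apply, Pi.smul_apply, smul_eq_mul]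
    ring
  have hne : ∀ {f : Mink}, f ∈ TimePlus → 2 * form p f / form f f ≠ 0 := fun hf =>
    div_ne_zero (mul_ne_zero two_ne_zero (form_neg_of_light_time hp hf).ne) (time_form_ne hf)
  rw [rot, rot, key]
  exact mul_ne_zero (mul_ne_zero (mul_ne_zero (hne hs) (hne ht)) (sub_ne_zero.mpr hst.symm)) hab

theorem rot_smul_left {c : ℚ} (hc : c ≠ 0) (f v : Mink) : rot (c • f) v = rot f v := by
  rw [rot, rot, form_smul_left, form_smul_right, form_smul_right, smul_smul]
  congr 2
  rcases eq_or_ne (form f f) 0 with h | h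
  · simp [h]
  · field_simp

theorem form_neg_of_time_mem_line {x y f : Mink} (hx : x ∈ LightPlus) (hy : y ∈ LightPlus)
    (hf : f ∈ TimePlus) (hfl : f ∈ line x y) : form x y < 0 := by
  obtain ⟨s, t, hs, ht, rfl⟩ := hfl
  have h1 := hf.1
  simp only [form_add_left, form_add_right, form_smul_left, form_smul_right, hx.1, hy.1,
    form_comm y x] at h1
  by_contra! h2
  have := mul_nonneg (mul_pos hs ht).le h2
  linarith

namespace IsPolygonConstruction

variable {n : ℕ} {v₀ vinf : Mink} {y x v f : ℕ → Mink}

/-- If the centres coincided, then ρ_{i+1} = ρ_i and v_{i+1} = v_{i-1}, although the vertices are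
distinct. -/
theorem f_succ_ne_smul (h : IsPolygonConstruction n v₀ vinf y x v f) (hn : 2 ≤ n)
    (hv₀ : v₀ ∈ LightPlus) (hvinf : vinf ∈ LightPlus)
    (hy : ∀ i, 1 ≤ i → i < n → y i ∈ LightPlus) (i : ℕ) (h1 : 1 ≤ i) (hi : i < n)
    (c : ℚ) (hc : c ≠ 0) : f (i + 1) ≠ c • f i := by
  intro e
  obtain ⟨i, rfl⟩ := Nat.exists_eq_add_of_le' h1
  have h2 := h.form_neg hn hv₀ hvinf hy i (i + 2) (by omega) hi
  rw [h.v_succ (i + 1) hi, e, rot_smul_left hc, h.v_succ i (by omega),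
    rot_rot (time_form_ne (h.f_mem _ hi.le)), (h.v_light hv₀ i (by omega)).1] at h2
  exact lt_irrefl _ h2

theorem setOf_rotPGL_eq (h : IsPolygonConstruction n v₀ vinf y x v f) (hn : 2 ≤ n)
    (hv₀ : v₀ ∈ LightPlus) (hvinf : vinf ∈ LightPlus)
    (hy : ∀ i, 1 ≤ i → i < n → y i ∈ LightPlus) :
    {g | ∃ i ≤ n, ∃ hf : f i ∈ TimePlus, g = rotPGL (f i) hf} =
      Set.range (h.isIdealPolygon hn hv₀ hvinf hy).gen := by
  ext g
  constructor
  · rintro ⟨i, hi, hf, rfl⟩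
    refine ⟨⟨i, Nat.lt_succ_of_le hi⟩, rfl⟩
  · rintro ⟨i, rfl⟩
    exact ⟨i, Nat.le_of_lt_succ i.2, h.f_mem _ (Nat.le_of_lt_succ i.2), rfl⟩

theorem polygonGroup_eq (h : IsPolygonConstruction n v₀ vinf y x v f) (hn : 2 ≤ n)
    (hv₀ : v₀ ∈ LightPlus) (hvinf : vinf ∈ LightPlus)
    (hy : ∀ i, 1 ≤ i → i < n → y i ∈ LightPlus) :
    polygonGroup n f = (h.isIdealPolygon hn hv₀ hvinf hy).group := by
  rw [polygonGroup, h.setOf_rotPGL_eq hn hv₀ hvinf hy, IsIdealPolygon.group]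

theorem isFiniteRelIndex (h : IsPolygonConstruction n v₀ vinf y x v f) (hn : 2 ≤ n)
    (hv₀ : v₀ ∈ LightPlus) (hvinf : vinf ∈ LightPlus)
    (hy : ∀ i, 1 ≤ i → i < n → y i ∈ LightPlus) :
    ((kernelPSL (polygonGroup n f)).map
      Matrix.ProjectiveSpecialLinearGroup.toPGL).IsFiniteRelIndex (polygonGroup n f) := by
  refine isFiniteRelIndex_kernelPSL ?_
  rw [h.setOf_rotPGL_eq hn hv₀ hvinf hy]
  exact Set.finite_range _

/-- The kernel contains a hyperbolic element with the axis from `x_i` to `y_i`. -/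
theorem exists_hyperbolic (h : IsPolygonConstruction n v₀ vinf y x v f) (hn : 2 ≤ n)
    (hv₀ : v₀ ∈ LightPlus) (hvinf : vinf ∈ LightPlus)
    (hy : ∀ i, 1 ≤ i → i < n → y i ∈ LightPlus) (i : ℕ) (h1 : 1 ≤ i) (hi : i < n) :
    form (x i) (y i) < 0 ∧ ∃ g : SL(2, ℝ),
      (QuotientGroup.mk g : PSL(2, ℝ)) ∈ (kernelPSL (polygonGroup n f)).map ratToReal ∧
      ∃ μ : ℝ, 0 < μ ∧ μ ≠ 1 ∧ ∀ a c a' c', IsParam (x i) a c → IsParam (y i) a' c' →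
        g.val * colMatrix a c a' c' = colMatrix a c a' c' * !![μ, 0; 0, μ⁻¹] := by
  have hx := h.x_light hy i h1 hi
  have hf := h.f_mem i hi.le
  have hf' := h.f_mem (i + 1) hi
  obtain ⟨hl, hl'⟩ := h.f_mem_line hy i h1 hi
  have hneg := form_neg_of_time_mem_line hx (hy i h1 hi) hf hl
  obtain ⟨g, hg, μ, hμ⟩ := RatFuchsian.exists_hyperbolic hx (hy i h1 hi) hneg hf hf' hl hl'
    (h.f_succ_ne_smul hn hv₀ hvinf hy i h1 hi) (Γ := polygonGroup n f)
    (Subgroup.subset_closure ⟨i, hi.le, hf, rfl⟩)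
    (Subgroup.subset_closure ⟨i + 1, hi, hf', rfl⟩)
  exact ⟨hneg, Matrix.SpecialLinearGroup.map (algebraMap ℚ ℝ) g, ⟨_, hg, rfl⟩, μ, hμ⟩

theorem bdry_mem_HFix (h : IsPolygonConstruction n v₀ vinf y x v f) (hn : 2 ≤ n)
    (hv₀ : v₀ ∈ LightPlus) (hvinf : vinf ∈ LightPlus)
    (hy : ∀ i, 1 ≤ i → i < n → y i ∈ LightPlus) (i : ℕ) (h1 : 1 ≤ i) (hi : i < n) :
    bdry (y i) ∈ HFix ((kernelPSL (polygonGroup n f)).map ratToReal) := by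
  obtain ⟨hneg, g, hg, μ, hμ, hμ1, hg'⟩ := h.exists_hyperbolic hn hv₀ hvinf hy i h1 hi
  obtain ⟨a, c, hac, -⟩ := exists_isParam (h.x_light hy i h1 hi)
  obtain ⟨a', c', hac', -⟩ := exists_isParam (hy i h1 hi)
  exact RatFuchsian.bdry_mem_HFix hg hμ hμ1 hac' (hac.ne_zero_of_form_neg hac' hneg)
    (hg' a c a' c' hac hac')

theorem isFuchsian (h : IsPolygonConstruction n v₀ vinf y x v f) (hn : 2 ≤ n)
    (hv₀ : v₀ ∈ LightPlus) (hvinf : vinf ∈ LightPlus)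
    (hy : ∀ i, 1 ≤ i → i < n → y i ∈ LightPlus) :
    IsFuchsian ((kernelPSL (polygonGroup n f)).map ratToReal) :=
  (h.isIdealPolygon hn hv₀ hvinf hy).isFuchsian (by rw [h.polygonGroup_eq hn hv₀ hvinf hy])

/-- The kernel determines the point `x₁` of the construction. -/
theorem form_x_one_eq_zero {x' v' f' : ℕ → Mink} (h : IsPolygonConstruction n v₀ vinf y x v f)
    (h' : IsPolygonConstruction n v₀ vinf y x' v' f') (hn : 2 ≤ n)
    (hv₀ : v₀ ∈ LightPlus) (hvinf : vinf ∈ LightPlus)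
    (hy : ∀ i, 1 ≤ i → i < n → y i ∈ LightPlus)
    (e : kernelPSL (polygonGroup n f) = kernelPSL (polygonGroup n f')) :
    form (x 1) (x' 1) = 0 := by
  obtain ⟨hneg, g, hg, μ, hμ, hμ1, hgm⟩ := h.exists_hyperbolic hn hv₀ hvinf hy 1 le_rfl hn
  obtain ⟨hneg', g', hg', μ', hμ', hμ1', hgm'⟩ :=
    h'.exists_hyperbolic hn hv₀ hvinf hy 1 le_rfl hn
  rw [← e] at hg'
  obtain ⟨a, c, hac, -⟩ := exists_isParam h.x_one_mem
  obtain ⟨a', c', hac', -⟩ := exists_isParam h'.x_one_mem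
  obtain ⟨α, γ, hαγ, -⟩ := exists_isParam (hy 1 le_rfl hn)
  -- Both hyperbolic elements lie in the same Fuchsian group and their axes end at y₁, so the other
  -- ends x₁ and x₁' agree.
  have h0 := (h.isFuchsian hn hv₀ hvinf hy).eq_of_common_end hg hg' hμ hμ1 hμ' hμ1'
    (hac.ne_zero_of_form_neg hαγ hneg) (hac'.ne_zero_of_form_neg hαγ hneg')
    (hgm _ _ _ _ hac hαγ) (hgm' _ _ _ _ hac' hαγ)
  have h1 := hac.form_eq hac'
  rw [h0] at h1
  norm_num at h1
  exact h1

end IsPolygonConstruction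

end RatFuchsian

end

theorem mainTheorem4 (n : ℕ) (hn : 2 ≤ n) (v₀ vinf : RatFuchsian.Mink)
    (y : ℕ → RatFuchsian.Mink)
    (hv₀ : v₀ ∈ RatFuchsian.LightPlus) (hvinf : vinf ∈ RatFuchsian.LightPlus)
    (hy : ∀ i, 1 ≤ i → i < n → y i ∈ RatFuchsian.LightPlus)
    (hv₀y : RatFuchsian.BLt vinf v₀ (y 1))
    (hyy : ∀ i, 1 ≤ i → i + 1 < n → RatFuchsian.BLt vinf (y i) (y (i + 1))) :
    {Δ : Subgroup PSL(2, ℚ) |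
      RatFuchsian.IsFuchsian (Δ.map RatFuchsian.ratToReal) ∧
      RatFuchsian.HasFiniteCovolume (Δ.map RatFuchsian.ratToReal) ∧
      ¬ RatFuchsian.IsCocompact (Δ.map RatFuchsian.ratToReal) ∧
      (∀ i, 1 ≤ i → i < n →
        RatFuchsian.bdry (y i) ∈ RatFuchsian.HFix (Δ.map RatFuchsian.ratToReal)) ∧
      ∃ x v f : ℕ → RatFuchsian.Mink,
        RatFuchsian.IsPolygonConstruction n v₀ vinf y x v f ∧
        Δ = RatFuchsian.kernelPSL (RatFuchsian.polygonGroup n f) ∧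
        (Δ.map Matrix.ProjectiveSpecialLinearGroup.toPGL).IsFiniteRelIndex
          (RatFuchsian.polygonGroup n f)}.Infinite := by
  open RatFuchsian in
  have hy1 := hy 1 le_rfl hn
  have hd : 0 < det3 vinf v₀ (y 1) := BLt_iff.mp hv₀y
  have hneg : form v₀ (y 1) < 0 :=
    form_neg_of_det3_ne_zero hv₀ hy1 hvinf (by rw [det3_rotate]; exact hd.ne')
  have hpos : ∀ k : ℕ, (0 : ℚ) < k + 1 := fun k => by positivity
  have htime : ∀ k : ℕ, v₀ + (k + 1 : ℚ) • y 1 ∈ TimePlus := fun k => by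
    simpa using time_of_line hv₀ hy1 hneg one_pos (hpos k)
  -- The half-turns about the different points v₀ + (k + 1) y₁ map v∞ to different points between v₀
  -- and y₁, which supplies infinitely many rational choices of x₁.
  have hcon : ∀ k : ℕ, ∃ x v f : ℕ → Mink, IsPolygonConstruction n v₀ vinf y x v f ∧
      x 1 = rot (v₀ + (k + 1 : ℚ) • y 1) vinf := by
    intro k
    obtain ⟨h1, h2, h3⟩ := rot_between hvinf hv₀ hy1 hd (f := v₀ + (k + 1 : ℚ) • y 1)
      ⟨1, _, one_pos, hpos k, by rw [one_smul]⟩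
    exact exists_polygonConstruction hn hv₀ hvinf hy hyy h1 (BLt_iff.mpr h2) (BLt_iff.mpr h3)
  choose x v f h hx using hcon
  refine Set.infinite_of_injective_forall_mem
    (f := fun k => kernelPSL (polygonGroup n (f k))) ?_ ?_
  · intro k l hkl
    by_contra hne
    have h0 := (h k).form_x_one_eq_zero (h l) hn hv₀ hvinf hy hkl
    -- Orthogonal light-like vectors lie on one ray, so equal kernels would make v∞ and the two
    -- choices of x₁ linearly dependent.
    have hsq := det3_sq hvinf.1 (h k).x_one_mem.1 (h l).x_one_mem.1
    rw [h0, mul_zero, zero_mul, sq_eq_zero_iff, hx, hx] at hsq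
    exact det3_rot_rot_ne_zero hvinf hd.ne' (fun e => hne (by exact_mod_cast add_right_cancel e)) (htime k)
      (htime l) hsq
  · intro k
    have hk := h k
    have hP := hk.isIdealPolygon hn hv₀ hvinf hy
    have hG := hk.polygonGroup_eq hn hv₀ hvinf hy
    have hfin := hk.isFiniteRelIndex hn hv₀ hvinf hy
    have hle : kernelPSL (polygonGroup n (f k)) ≤ kernelPSL hP.group := by rw [hG]
    refine ⟨hk.isFuchsian hn hv₀ hvinf hy, ?_, hP.not_isCocompact 0 hle,
      hk.bdry_mem_HFix hn hv₀ hvinf hy, x k, v k, f k, hk, rfl, hfin⟩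
    exact hP.hasFiniteCovolume (hk.volume_lt_top hn hv₀ hvinf hy) hle (by rwa [hG] at hfin ⊢)
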